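/- **Setting.** Let $\mathbf Y$ be a real Banach space and let $\mathbf V\subset\mathbf Y$ be a separable reflexive Banach space whose embedding into $\mathbf Y$ is compact. For $x\in\mathbf Y$ let $g_x$ be a symmetric bilinear form on $\mathbf V$ with $$c^*\|v\|_{\mathbf V}^2\le g_x(v,v)\le C^*\|v\|_{\mathbf V}^2,\qquad |g_x(v,v)-g_{\tilde x}(v,v)|\le\beta(\|x-\tilde x\|_{\mathbf Y})\,\|v\|_{\mathbf V}^2$$ for all $x,\tilde x\in\mathbf Y$ and $v\in\mathbf V$, where $c^*>0$ and $C^*<\infty$ are constants and $\beta$ is continuous and strictly increasing on $[0,\infty)$ with $\beta(0)=0$. The energy of a path $x:[0,1]\to\mathbf Y$ is $\mathcal E[x]=\int_0^1 g_{x(t)}(\dot x(t),\dot x(t))\,dt$ if $x\in x(0)+W^{1,2}((0,1);\mathbf V)$, and $\mathcal E[x]=\infty$ otherwise. Put $$\mathrm{dist}(x,\tilde x)=\Big(\inf\{\mathcal E[p]: p(0)=x,\ p(1)=\tilde x\}\Big)^{1/2}\in[0,\infty].$$ Let $\mathcal W:\mathbf Y\times\mathbf Y\to\mathbb R\cup\{\infty\}$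 be lower semicontinuous with the following properties. * There are constants $C$ and $\delta>0$ such that $\mathcal W[x,\tilde x]$ is finite and $|\mathcal W[x,\tilde x]-\mathrm{dist}^2(x,\tilde x)|\le C\,\mathrm{dist}^3(x,\tilde x)$ whenever $\mathrm{dist}(x,\tilde x)\le\delta$. * $\mathcal W[x,\tilde x]\ge\gamma(\mathrm{dist}(x,\tilde x))$ whenever $\mathrm{dist}(x,\tilde x)<\infty$, where $\gamma$ is continuous and strictly increasing on $[0,\infty)$ with $\gamma(0)=0$. Let $x_A\in\mathbf Y$, $\mathcal M=x_A+\mathbf V$ and $x_B\in\mathcal M$. A continuous geodesic from $x_A$ to $x_B$ is a minimizer of $\mathcal E$ among all paths from $x_A$ to $x_B$. A discrete geodesic of order $K\ge1$ from $x_A$ to $x_B$ is a tuple $(x_0,\dots,x_K)\in\mathcal M^{K+1}$ that minimizes $K\sum_{k=1}^K\mathcal W[x_{k-1},x_k]$ among all such tuples with $x_0=x_A$ and $x_K=x_B$. **Theorem.** Assume * (H1) the map $x\mapsto g_x$ from $\mathbf Y$ to the bounded bilinear forms on $\mathbf V$ is $C^2$; * (H2) $\mathcal W$ is finite and $C^4$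 on $\mathcal M\times\mathcal M$ (identified with $\mathbf V\times\mathbf V$), and its derivatives of orders $1,\dots,4$ are bounded on bounded sets (in particular, they may be globally bounded). Let $x:[0,1]\to\mathbf Y$ be a continuous geodesic from $x_A$ to $x_B$. For every $K\ge1$ let $x_\tau$, $\tau=1/K$, be the piecewise linear interpolation, at the nodes $k\tau$, of a discrete geodesic of order $K$ from $x_A$ to $x_B$. If $x_\tau\to x$ in $L^2((0,1);\mathbf Y)$ as $K\to\infty$, then $x$ and all $x_\tau$ belong to $W^{1,2}((0,1);\mathcal M):=x_A+W^{1,2}((0,1);\mathbf V)$, and the convergence holds in this space: $$\int_0^1\|x_\tau-x\|_{\mathbf V}^2+\|\dot x_\tau-\dot x\|_{\mathbf V}^2\,dt\longrightarrow0\qquad(K\to\infty).$$ -/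

import Mathlib

open MeasureTheory Set Filter Topology
open scoped ENNReal

namespace DiscreteGeodesics

section

variable {Y V : Type*} [NormedAddCommGroup Y] [NormedSpace ℝ Y]
  [NormedAddCommGroup V] [NormedSpace ℝ V]

/-- Lebesgue measure on the open unit interval `(0, 1)`. -/
noncomputable def unitMeasure : Measure ℝ := volume.restrict (Ioo 0 1)

/-- The affine manifold `xA + V` inside `Y`, where `V` is regarded as a subspace of `Y` through the
embedding `ι`. -/
def manifold (ι : V →L[ℝ] Y) (xA : Y) : Set Y := {x | ∃ u : V, x = xA + ι u}

/-- `v ∈ L²((0,1); V)` is the velocity (weak derivative) of the path `x : [0,1] → Y`: the path is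
absolutely continuous and `x(t) = x(0) + ∫₀ᵗ v`. This is the usual description, through the
absolutely continuous representative, of `x ∈ x(0) + W^{1,2}((0,1); V)` with `ẋ = v`. Only the
values on `[0, 1]` matter, and `v` is unique up to null sets if `ι` is injective. -/
def HasVelocity (ι : V →L[ℝ] Y) (x : ℝ → Y) (v : ℝ → V) : Prop :=
  MemLp v 2 unitMeasure ∧ ∀ t ∈ Icc (0 : ℝ) 1, x t = x 0 + ι (∫ s in (0 : ℝ)..t, v s)

/-- The path energy `∫₀¹ g_{x(t)}(ẋ(t), ẋ(t)) dt`, with value `∞` if the path has no velocity in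
`L²((0,1); V)`. -/
noncomputable def pathEnergy (ι : V →L[ℝ] Y) (g : Y → V →L[ℝ] V →L[ℝ] ℝ) (x : ℝ → Y) : ℝ≥0∞ :=
  ⨅ (v : ℝ → V) (_ : HasVelocity ι x v), ∫⁻ t, ENNReal.ofReal (g (x t) (v t) (v t)) ∂unitMeasure

/-- The Riemannian distance on `Y`: the square root of the least energy of a connecting path
(`∞` if no path of finite energy connects the two points). -/
noncomputable def riemDist (ι : V →L[ℝ] Y) (g : Y → V →L[ℝ] V →L[ℝ] ℝ) (x y : Y) : ℝ≥0∞ :=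
  (⨅ (p : ℝ → Y) (_ : p 0 = x) (_ : p 1 = y), pathEnergy ι g p) ^ (1 / 2 : ℝ)

/-- A continuous geodesic from `xA` to `xB`: a minimizer of the path energy among all paths with
these end points. -/
def IsGeodesic (ι : V →L[ℝ] Y) (g : Y → V →L[ℝ] V →L[ℝ] ℝ) (xA xB : Y) (x : ℝ → Y) : Prop :=
  x 0 = xA ∧ x 1 = xB ∧
    ∀ p : ℝ → Y, p 0 = xA → p 1 = xB → pathEnergy ι g x ≤ pathEnergy ι g p

/-- The discrete path energy `K ∑_{k=1}^K W[x_{k-1}, x_k]` of a discrete path `(x_0, …, x_K)`.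
A discrete path is given as a sequence of which only the entries `0, …, K` matter. -/
noncomputable def discreteEnergy (W : Y → Y → EReal) (K : ℕ) (x : ℕ → Y) : EReal :=
  (K : EReal) * ∑ k ∈ Finset.range K, W (x k) (x (k + 1))

/-- `(x_0, …, x_K)` is a discrete path on `xA + V` from `xA` to `xB`. -/
def IsDiscretePath (ι : V →L[ℝ] Y) (xA xB : Y) (K : ℕ) (x : ℕ → Y) : Prop :=
  x 0 = xA ∧ x K = xB ∧ ∀ k ≤ K, x k ∈ manifold ι xA

/-- A discrete geodesic of order `K` from `xA` to `xB`: a minimizer of the discrete path energy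
among all discrete paths on `xA + V` with these end points. -/
def IsDiscreteGeodesic (ι : V →L[ℝ] Y) (W : Y → Y → EReal) (xA xB : Y) (K : ℕ) (x : ℕ → Y) :
    Prop :=
  IsDiscretePath ι xA xB K x ∧
    ∀ y : ℕ → Y, IsDiscretePath ι xA xB K y → discreteEnergy W K x ≤ discreteEnergy W K y

/-- The piecewise linear interpolation `x_τ : [0,1] → Y`, `τ = 1/K`, of `(x_0, …, x_K)`, which is
affine on each `[kτ, (k+1)τ]` and satisfies `x_τ(kτ) = x_k`. -/
noncomputable def interpolate (K : ℕ) (x : ℕ → Y) (t : ℝ) : Y :=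
  x ⌊(K : ℝ) * t⌋₊ + ((K : ℝ) * t - (⌊(K : ℝ) * t⌋₊ : ℝ)) •
    (x (⌊(K : ℝ) * t⌋₊ + 1) - x ⌊(K : ℝ) * t⌋₊)

/-- The norm `(‖z‖²_{L²((0,1);V)} + ‖ż‖²_{L²((0,1);V)})^{1/2}` of `W^{1,2}((0,1); V)`, for a
function `z : [0,1] → Y`; it is `∞` if `z` does not belong to `W^{1,2}((0,1); V)`. -/
noncomputable def w12Norm (ι : V →L[ℝ] Y) (z : ℝ → Y) : ℝ≥0∞ :=
  ⨅ (u : ℝ → V) (v : ℝ → V) (_ : HasVelocity (ContinuousLinearMap.id ℝ V) u v)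
    (_ : ∀ t ∈ Icc (0 : ℝ) 1, z t = ι (u t)),
    ((eLpNorm u 2 unitMeasure) ^ 2 + (eLpNorm v 2 unitMeasure) ^ 2) ^ (1 / 2 : ℝ)

/-- The function `W` on `(xA + V) × (xA + V)`, read as a real function on `V × V`. -/
noncomputable def onManifold (ι : V →L[ℝ] Y) (W : Y → Y → EReal) (xA : Y) (p : V × V) : ℝ :=
  (W (xA + ι p.1) (xA + ι p.2)).toReal

end

/-- A modulus: continuous and strictly increasing on `[0, ∞)`, vanishing at `0`. -/
def IsModulus (β : ℝ → ℝ) : Prop :=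
  StrictMonoOn β (Ici 0) ∧ ContinuousOn β (Ici 0) ∧ β 0 = 0

end DiscreteGeodesics

/-!
The proof compares energies. Write `v` for the velocity of `x`, `E = ∫₀¹ g_x(v, v)` for its energy,
and `v_K` for the (piecewise constant) velocity of the interpolation of order `K`.

*Upper bound.* Sampling `x` at the grid points gives a competitor for the discrete problem. Since
the squared distance of neighbouring samples is at most `1/K` times the energy of the piece of `x`
between them, and `W` agrees with the squared distance up to third order, the competitor has
discrete energy at most `E + o(1)` (`sampled_energy_le`), and so have the discrete geodesics.

*Back to the interpolation.* A bound on the discrete energy forces each `W[x_{k-1}, x_k]` to be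
`O(1/K)`; as `W ≥ γ(dist)`, all steps of the discrete geodesics become uniformly short. For short
steps `W` is close to `dist²`, and `dist²(y, y + u)` is bounded below by nearly `g_y(u, u)`, because
a path of small energy stays near `y` in `Y`, where `g` is nearly constant, and then Jensen's
inequality applies (`apply_le_riemDist_sq`). Thus `∫₀¹ g(v_K, v_K) ≤ E + o(1)`, with the metric
taken at the left nodes (`eventually_step_energy_le`).

*Strong convergence.* By coercivity `v_K` is bounded in `L²((0,1); V)`, so the interpolations are
equicontinuous in `Y` and converge to `x` uniformly (`eventually_norm_le_of_tendsto`). Reflexivity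
makes the functionals coming from `Y` dense in the dual of `V`, whence `v_K ⇀ v` weakly in `L²`
(`tendsto_integral_apply`). Expanding the square,
`∫ g_x(v_K - v, v_K - v) = ∫ g_x(v_K, v_K) - E - 2 ∫ g_x(v, v_K - v) ≤ o(1)`,
and coercivity of `g` turns this into `v_K → v` in `L²((0,1); V)`
(`tendsto_integral_norm_sub_sq`).
-/

namespace DiscreteGeodesics

/-! ### Step functions and piecewise linear interpolation -/

section StepFunctions

variable {E : Type*} [NormedAddCommGroup E]

instance isProbabilityMeasure_unitMeasure : IsProbabilityMeasure unitMeasure :=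
  ⟨by simp [unitMeasure]⟩

theorem integral_unitMeasure [NormedSpace ℝ E] (f : ℝ → E) :
    ∫ t, f t ∂unitMeasure = ∫ t in (0 : ℝ)..1, f t := by
  rw [intervalIntegral.integral_of_le zero_le_one, integral_Ioc_eq_integral_Ioo, unitMeasure]

theorem integrable_unitMeasure_iff {f : ℝ → E} :
    Integrable f unitMeasure ↔ IntervalIntegrable f volume 0 1 := by
  rw [intervalIntegrable_iff_integrableOn_Ioo_of_le zero_le_one]; rfl

theorem intervalIntegrable_of_integrable {f : ℝ → E} (hf : Integrable f unitMeasure) {a b : ℝ}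
    (ha : a ∈ Icc (0 : ℝ) 1) (hb : b ∈ Icc (0 : ℝ) 1) : IntervalIntegrable f volume a b := by
  refine (integrable_unitMeasure_iff.1 hf).mono_set ?_
  rw [uIcc_of_le zero_le_one]
  exact uIcc_subset_Icc ha hb

theorem floor_eq_of_mem_cell {K : ℕ} (hK : 1 ≤ K) (n : ℕ) {t : ℝ}
    (ht : t ∈ Ico ((n : ℝ) / K) (((n + 1 : ℕ) : ℝ) / K)) : ⌊(K : ℝ) * t⌋₊ = n := by
  have hK' : (0 : ℝ) < K := by exact_mod_cast hK
  obtain ⟨h1, h2⟩ := ht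
  rw [div_le_iff₀ hK'] at h1
  rw [lt_div_iff₀ hK'] at h2
  rw [Nat.floor_eq_iff (by nlinarith [Nat.cast_nonneg (α := ℝ) n])]
  push_cast at h2
  exact ⟨by linarith, by linarith⟩

theorem stronglyMeasurable_step (K : ℕ) (h : ℕ → E) :
    StronglyMeasurable fun t : ℝ => h ⌊(K : ℝ) * t⌋₊ :=
  (StronglyMeasurable.of_discrete (f := h)).comp_measurable
    (Nat.measurable_floor.comp (measurable_const_mul (K : ℝ)))

theorem floor_le_of_mem {K : ℕ} {t : ℝ} (ht : t ∈ Icc (0 : ℝ) 1) : ⌊(K : ℝ) * t⌋₊ ≤ K := by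
  refine Nat.floor_le_of_le ?_
  nlinarith [ht.2, Nat.cast_nonneg (α := ℝ) K]

theorem memLp_step (K : ℕ) (h : ℕ → E) (p : ℝ≥0∞) :
    MemLp (fun t : ℝ => h ⌊(K : ℝ) * t⌋₊) p unitMeasure := by
  refine MemLp.of_bound (stronglyMeasurable_step K h).aestronglyMeasurable
    (∑ k ∈ Finset.range (K + 1), ‖h k‖) ?_
  refine (ae_restrict_iff' measurableSet_Ioo).2 (Eventually.of_forall fun t ht => ?_)
  exact Finset.single_le_sum (f := fun k => ‖h k‖) (fun _ _ => norm_nonneg _)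
    (Finset.mem_range.2 (Nat.lt_succ_of_le (floor_le_of_mem ⟨ht.1.le, ht.2.le⟩)))

/-- On the `n`-th cell of the grid of width `1/K`, a step function is constant. -/
theorem integral_step_cell [NormedSpace ℝ E] [CompleteSpace E] {K : ℕ} (hK : 1 ≤ K) (h : ℕ → E)
    (n : ℕ) {t : ℝ} (ht : t ∈ Icc ((n : ℝ) / K) (((n + 1 : ℕ) : ℝ) / K)) :
    ∫ s in ((n : ℝ) / K)..t, h ⌊(K : ℝ) * s⌋₊ = (t - (n : ℝ) / K) • h n := by
  rw [← intervalIntegral.integral_const]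
  refine intervalIntegral.integral_congr_Ioo_of_le ht.1 fun s hs => ?_
  simp only [floor_eq_of_mem_cell hK n ⟨hs.1.le, hs.2.trans_le ht.2⟩]

theorem grid_mem {K n : ℕ} (hK : 1 ≤ K) (hn : n ≤ K) : (n : ℝ) / K ∈ Icc (0 : ℝ) 1 := by
  have hK' : (0 : ℝ) < K := by exact_mod_cast hK
  refine ⟨by positivity, ?_⟩
  rw [div_le_one hK']
  exact_mod_cast hn

theorem grid_succ_sub {K : ℕ} (n : ℕ) :
    ((n + 1 : ℕ) : ℝ) / K - (n : ℝ) / K = 1 / K := by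
  push_cast; ring

theorem grid_le_succ {K : ℕ} (n : ℕ) : (n : ℝ) / K ≤ ((n + 1 : ℕ) : ℝ) / K := by
  gcongr
  simp

theorem sum_integral_grid [NormedSpace ℝ E] {K : ℕ} (hK : 1 ≤ K) {f : ℝ → E}
    (hf : Integrable f unitMeasure) {n : ℕ} (hn : n ≤ K) :
    ∑ k ∈ Finset.range n, ∫ s in ((k : ℝ) / K)..(((k + 1 : ℕ) : ℝ) / K), f s =
      ∫ s in (0 : ℝ)..((n : ℝ) / K), f s := by
  rw [intervalIntegral.sum_integral_adjacent_intervals (a := fun k : ℕ => (k : ℝ) / K)]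
  · simp
  · intro k hk
    exact intervalIntegrable_of_integrable hf (grid_mem hK (by omega)) (grid_mem hK (by omega))

theorem integral_step [NormedSpace ℝ E] [CompleteSpace E] {K : ℕ} (hK : 1 ≤ K) (h : ℕ → E) {n : ℕ}
    (hn : n ≤ K) :
    ∫ s in (0 : ℝ)..((n : ℝ) / K), h ⌊(K : ℝ) * s⌋₊ =
      (1 / K : ℝ) • ∑ k ∈ Finset.range n, h k := by
  rw [← sum_integral_grid hK ((memLp_step K h 1).integrable le_rfl) hn, Finset.smul_sum]
  refine Finset.sum_congr rfl fun k _ => ?_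
  rw [integral_step_cell hK h k ⟨grid_le_succ k, le_rfl⟩, grid_succ_sub]

theorem integral_unitMeasure_step [NormedSpace ℝ E] [CompleteSpace E] {K : ℕ} (hK : 1 ≤ K)
    (h : ℕ → E) :
    ∫ s, h ⌊(K : ℝ) * s⌋₊ ∂unitMeasure = (1 / K : ℝ) • ∑ k ∈ Finset.range K, h k := by
  have hK' : (K : ℝ) ≠ 0 := by exact_mod_cast (by omega : K ≠ 0)
  rw [integral_unitMeasure, ← integral_step hK h le_rfl, div_self hK']

/-- The difference quotients `K (c_{k+1} - c_k)` as a step function: the derivative of the piecewise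
linear interpolation of `c` with step size `1/K`. -/
noncomputable def stepVel [NormedSpace ℝ E] (K : ℕ) (c : ℕ → E) (t : ℝ) : E :=
  (K : ℝ) • (c (⌊(K : ℝ) * t⌋₊ + 1) - c ⌊(K : ℝ) * t⌋₊)

theorem memLp_stepVel [NormedSpace ℝ E] (K : ℕ) (c : ℕ → E) (p : ℝ≥0∞) :
    MemLp (stepVel K c) p unitMeasure :=
  memLp_step K (fun k => (K : ℝ) • (c (k + 1) - c k)) p

theorem integral_stepVel [NormedSpace ℝ E] [CompleteSpace E] {K : ℕ} (hK : 1 ≤ K) (c : ℕ → E)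
    {t : ℝ} (ht : t ∈ Icc (0 : ℝ) 1) :
    ∫ s in (0 : ℝ)..t, stepVel K c s = interpolate K c t - c 0 := by
  have hK' : (0 : ℝ) < K := by exact_mod_cast hK
  set n := ⌊(K : ℝ) * t⌋₊ with hn
  have hnK : n ≤ K := floor_le_of_mem ht
  have h1 : (n : ℝ) / K ≤ t := by
    rw [div_le_iff₀ hK', mul_comm]
    exact Nat.floor_le (mul_nonneg hK'.le ht.1)
  have h2 : t ≤ ((n + 1 : ℕ) : ℝ) / K := by
    rw [le_div_iff₀ hK', mul_comm]
    exact_mod_cast (Nat.lt_floor_add_one ((K : ℝ) * t)).le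
  have hint := (memLp_stepVel K c 1).integrable le_rfl
  have h0 : (0 : ℝ) ∈ Icc (0 : ℝ) 1 := by simp
  rw [← intervalIntegral.integral_add_adjacent_intervals
    (intervalIntegrable_of_integrable hint h0 (grid_mem hK hnK))
    (intervalIntegrable_of_integrable hint (grid_mem hK hnK) ht)]
  have e1 := integral_step hK (fun k => (K : ℝ) • (c (k + 1) - c k)) hnK
  have e2 := integral_step_cell hK (fun k => (K : ℝ) • (c (k + 1) - c k)) n ⟨h1, h2⟩
  rw [← Finset.smul_sum, Finset.sum_range_sub, smul_smul, one_div_mul_cancel hK'.ne', one_smul]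
    at e1
  simp only [stepVel]
  rw [e1, e2, interpolate, ← hn, smul_smul,
    show (t - (n : ℝ) / K) * K = K * t - n by field_simp]
  abel

end StepFunctions

/-! ### Paths with square integrable velocity -/

section Velocity

variable {Y V : Type*} [NormedAddCommGroup Y] [NormedSpace ℝ Y]
  [NormedAddCommGroup V] [NormedSpace ℝ V]

theorem interpolate_eq_integral [CompleteSpace V] (ι : V →L[ℝ] Y) {K : ℕ} (hK : 1 ≤ K) {xA : Y}
    {x : ℕ → Y} {c : ℕ → V} (hc : ∀ k ≤ K, x k = xA + ι (c k)) {t : ℝ} (ht : t ∈ Icc (0 : ℝ) 1) :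
    interpolate K x t = x 0 + ι (∫ s in (0 : ℝ)..t, stepVel K c s) := by
  rw [integral_stepVel hK c ht, hc 0 (by omega), interpolate, interpolate]
  have hn : ⌊(K : ℝ) * t⌋₊ ≤ K := floor_le_of_mem ht
  rcases hn.lt_or_eq with h | h
  · rw [hc _ hn, hc _ (by omega)]
    simp only [map_add, map_sub, map_smul]
    rw [add_sub_add_left_eq_sub]
    abel
  · -- at the right end point the entry `K + 1` has weight zero
    have hz : (K : ℝ) * t - (⌊(K : ℝ) * t⌋₊ : ℝ) = 0 := by
      have := Nat.floor_le (mul_nonneg (Nat.cast_nonneg (α := ℝ) K) ht.1)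
      rw [h] at this ⊢
      nlinarith [ht.2, Nat.cast_nonneg (α := ℝ) K]
    rw [hz, hc _ hn]
    simp only [zero_smul, add_zero, map_sub]
    abel

theorem integral_norm_le_sqrt {E : Type*} [NormedAddCommGroup E] {v : ℝ → E} {a b : ℝ}
    (hab : a ≤ b) (ha : a ∈ Icc (0 : ℝ) 1) (hb : b ∈ Icc (0 : ℝ) 1) (hv : MemLp v 2 unitMeasure) :
    ∫ s in a..b, ‖v s‖ ≤ √(b - a) * √(∫ s in a..b, ‖v s‖ ^ 2) := by
  have hi : IntervalIntegrable (fun s => ‖v s‖) volume a b :=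
    intervalIntegrable_of_integrable (hv.norm.integrable one_le_two) ha hb
  have hi2 : IntervalIntegrable (fun s => ‖v s‖ ^ 2) volume a b :=
    intervalIntegrable_of_integrable hv.norm.integrable_sq ha hb
  set A := ∫ s in a..b, ‖v s‖
  set B := ∫ s in a..b, ‖v s‖ ^ 2
  have hB : 0 ≤ B := intervalIntegral.integral_nonneg hab fun _ _ => by positivity
  rw [← Real.sqrt_mul (sub_nonneg.2 hab)]
  refine Real.le_sqrt_of_sq_le ?_
  rcases hab.eq_or_lt with rfl | hlt
  · simp [A]
  -- the integral of the square of `(b - a)‖v‖ - A` is nonnegative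
  have h0 : 0 ≤ ∫ s in a..b, ((b - a) * ‖v s‖ - A) ^ 2 :=
    intervalIntegral.integral_nonneg hab fun _ _ => sq_nonneg _
  have h1 : ∫ s in a..b, ((b - a) * ‖v s‖ - A) ^ 2 =
      (b - a) ^ 2 * B - 2 * (b - a) * A * A + (b - a) * A ^ 2 := by
    have : ∀ s, ((b - a) * ‖v s‖ - A) ^ 2 =
        (b - a) ^ 2 * ‖v s‖ ^ 2 - 2 * (b - a) * A * ‖v s‖ + A ^ 2 := fun s => by ring
    simp only [this]
    rw [intervalIntegral.integral_add ((hi2.const_mul _).sub (hi.const_mul _))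
      intervalIntegrable_const, intervalIntegral.integral_sub (hi2.const_mul _) (hi.const_mul _),
      intervalIntegral.integral_const_mul, intervalIntegral.integral_const_mul,
      intervalIntegral.integral_const, smul_eq_mul]
  rw [h1] at h0
  have h2 : 0 ≤ (b - a) * ((b - a) * B - A ^ 2) := by nlinarith
  have := nonneg_of_mul_nonneg_right h2 (sub_pos.2 hlt)
  linarith

theorem norm_integral_le_sqrt {E : Type*} [NormedAddCommGroup E] [NormedSpace ℝ E] {v : ℝ → E}
    {a b : ℝ} (hab : a ≤ b) (ha : a ∈ Icc (0 : ℝ) 1) (hb : b ∈ Icc (0 : ℝ) 1)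
    (hv : MemLp v 2 unitMeasure) :
    ‖∫ s in a..b, v s‖ ≤ √(b - a) * √(∫ s, ‖v s‖ ^ 2 ∂unitMeasure) := by
  refine (intervalIntegral.norm_integral_le_integral_norm hab).trans
    ((integral_norm_le_sqrt hab ha hb hv).trans ?_)
  gcongr
  rw [integral_unitMeasure]
  exact intervalIntegral.integral_mono_interval ha.1 hab hb.2
    (Eventually.of_forall fun _ => by positivity)
    (integrable_unitMeasure_iff.1 hv.norm.integrable_sq)

theorem continuousOn_primitive {v : ℝ → V} (hv : MemLp v 2 unitMeasure) :
    ContinuousOn (fun t => ∫ s in (0 : ℝ)..t, v s) (Icc 0 1) := by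
  have := intervalIntegral.continuousOn_primitive_interval (f := v) (a := 0) (b := 1) (μ := volume)
    (by
      rw [uIcc_of_le zero_le_one, integrableOn_Icc_iff_integrableOn_Ioo]
      exact hv.integrable one_le_two)
  rwa [uIcc_of_le zero_le_one] at this

theorem eLpNorm_two_sq {E : Type*} [NormedAddCommGroup E] {v : ℝ → E}
    (hv : MemLp v 2 unitMeasure) :
    eLpNorm v 2 unitMeasure ^ 2 = ENNReal.ofReal (∫ s, ‖v s‖ ^ 2 ∂unitMeasure) := by
  rw [ofReal_integral_eq_lintegral_ofReal hv.norm.integrable_sq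
    (Eventually.of_forall fun _ => by positivity)]
  have := eLpNorm_nnreal_pow_eq_lintegral (f := v) (μ := unitMeasure) (p := 2) two_ne_zero
  norm_num at this
  rw [this]
  refine lintegral_congr fun s => ?_
  rw [← ofReal_norm, ENNReal.ofReal_pow (norm_nonneg _)]

theorem w12Norm_le (ι : V →L[ℝ] Y) {z : ℝ → Y} {v : ℝ → V} (hv : MemLp v 2 unitMeasure)
    (hz : ∀ t ∈ Icc (0 : ℝ) 1, z t = ι (∫ s in (0 : ℝ)..t, v s)) :
    w12Norm ι z ≤ ENNReal.ofReal (2 * ∫ s, ‖v s‖ ^ 2 ∂unitMeasure) ^ (1 / 2 : ℝ) := by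
  set u : ℝ → V := fun t => ∫ s in (0 : ℝ)..t, v s
  have hB : 0 ≤ ∫ s, ‖v s‖ ^ 2 ∂unitMeasure := integral_nonneg fun _ => by positivity
  have hvel : HasVelocity (ContinuousLinearMap.id ℝ V) u v :=
    ⟨hv, fun t _ => by simp [u]⟩
  refine le_trans (iInf₂_le_of_le u v (iInf₂_le_of_le hvel hz le_rfl)) ?_
  gcongr
  have hum : AEStronglyMeasurable u unitMeasure :=
    ((continuousOn_primitive hv).mono Ioo_subset_Icc_self).aestronglyMeasurable measurableSet_Ioo
  have hb : ∀ᵐ t ∂unitMeasure, ‖u t‖ ≤ √(∫ s, ‖v s‖ ^ 2 ∂unitMeasure) := by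
    refine (ae_restrict_iff' measurableSet_Ioo).2 (Eventually.of_forall fun t ht => ?_)
    refine (norm_integral_le_sqrt ht.1.le (by simp) ⟨ht.1.le, ht.2.le⟩ hv).trans ?_
    refine mul_le_of_le_one_left (Real.sqrt_nonneg _) ?_
    rw [Real.sqrt_le_iff]
    refine ⟨zero_le_one, ?_⟩
    linarith [ht.2]
  have hu : MemLp u 2 unitMeasure := MemLp.of_bound hum _ hb
  rw [eLpNorm_two_sq hv, eLpNorm_two_sq hu,
    ← ENNReal.ofReal_add (integral_nonneg fun _ => by positivity) hB]
  refine ENNReal.ofReal_le_ofReal ?_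
  have : ∫ s, ‖u s‖ ^ 2 ∂unitMeasure ≤ ∫ _, (∫ s, ‖v s‖ ^ 2 ∂unitMeasure) ∂unitMeasure := by
    refine integral_mono_ae hu.norm.integrable_sq (integrable_const _) ?_
    filter_upwards [hb] with t ht
    calc ‖u t‖ ^ 2 ≤ _ := pow_le_pow_left₀ (norm_nonneg _) ht 2
      _ = _ := Real.sq_sqrt hB
  simp only [integral_const, probReal_univ, one_smul] at this
  linarith

end Velocity

/-! ### The metric, path energies and the Riemannian distance -/

section Metric

variable {Y V : Type*} [NormedAddCommGroup Y]
  [NormedAddCommGroup V] [NormedSpace ℝ V]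

/-- A Riemannian metric on `Y` acting on directions in `V`: symmetric, continuous in the base point,
uniformly equivalent to the norm of `V`, and with the modulus of continuity `β` for the quadratic
forms. -/
structure IsUniformMetric (g : Y → V →L[ℝ] V →L[ℝ] ℝ) (cs Cs : ℝ) (β : ℝ → ℝ) : Prop where
  symm : ∀ x v w, g x v w = g x w v
  pos : 0 < cs
  coer : ∀ x v, cs * ‖v‖ ^ 2 ≤ g x v v
  bdd : ∀ x v, g x v v ≤ Cs * ‖v‖ ^ 2
  modulus : IsModulus β
  cont : ∀ x y v, |g x v v - g y v v| ≤ β ‖x - y‖ * ‖v‖ ^ 2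
  continuous : Continuous g

theorem IsModulus.mono {β : ℝ → ℝ} (h : IsModulus β) {r s : ℝ} (hr : 0 ≤ r) (hrs : r ≤ s) :
    β r ≤ β s :=
  h.1.monotoneOn hr (hr.trans hrs) hrs

theorem IsModulus.nonneg {β : ℝ → ℝ} (h : IsModulus β) {r : ℝ} (hr : 0 ≤ r) : 0 ≤ β r := by
  simpa [h.2.2] using h.mono le_rfl hr

theorem IsModulus.tendsto_zero {β : ℝ → ℝ} (h : IsModulus β) {α : Type*} {l : Filter α} {r : α → ℝ}
    (h0 : ∀ᶠ a in l, 0 ≤ r a) (hr : Tendsto r l (𝓝 0)) : Tendsto (fun a => β (r a)) l (𝓝 0) := by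
  have h1 := h.2.1 0 (by simp : (0 : ℝ) ∈ Ici 0)
  unfold ContinuousWithinAt at h1
  rw [h.2.2] at h1
  exact h1.comp (tendsto_nhdsWithin_iff.2 ⟨hr, h0⟩)

namespace IsUniformMetric

variable {g : Y → V →L[ℝ] V →L[ℝ] ℝ} {cs Cs : ℝ} {β : ℝ → ℝ}

theorem nonneg (hg : IsUniformMetric g cs Cs β) (x : Y) (v : V) : 0 ≤ g x v v :=
  (mul_nonneg hg.pos.le (sq_nonneg _)).trans (hg.coer x v)

/-- Cauchy–Schwarz. -/
theorem sq_apply_le (hg : IsUniformMetric g cs Cs β) (x : Y) (v w : V) :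
    g x v w ^ 2 ≤ g x v v * g x w w := by
  have h : ∀ t : ℝ, 0 ≤ g x v v * (t * t) + 2 * g x v w * t + g x w w := fun t => by
    have := hg.nonneg x (t • v + w)
    simp only [map_add, map_smul, add_apply, smul_apply,
      smul_eq_mul, hg.symm x w v] at this
    linarith
  have := discrim_le_zero h
  unfold discrim at this
  nlinarith

theorem abs_apply_le (hg : IsUniformMetric g cs Cs β) (x : Y) (v w : V) :
    |g x v w| ≤ |Cs| * ‖v‖ * ‖w‖ := by
  refine abs_le_of_sq_le_sq ?_ (by positivity)
  have h1 : ∀ u, g x u u ≤ |Cs| * ‖u‖ ^ 2 := fun u =>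
    (hg.bdd x u).trans (mul_le_mul_of_nonneg_right (le_abs_self _) (sq_nonneg _))
  calc g x v w ^ 2 ≤ g x v v * g x w w := hg.sq_apply_le x v w
    _ ≤ (|Cs| * ‖v‖ ^ 2) * (|Cs| * ‖w‖ ^ 2) :=
      mul_le_mul (h1 v) (h1 w) (hg.nonneg x w) (by positivity)
    _ = _ := by ring

theorem norm_apply_le (hg : IsUniformMetric g cs Cs β) (x : Y) (v : V) :
    ‖g x v‖ ≤ |Cs| * ‖v‖ :=
  ContinuousLinearMap.opNorm_le_bound _ (by positivity) fun w => hg.abs_apply_le x v w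

theorem memLp_apply (hg : IsUniformMetric g cs Cs β) {X : ℝ → Y} {v : ℝ → V}
    (hX : AEStronglyMeasurable X unitMeasure) (hv : MemLp v 2 unitMeasure) :
    MemLp (fun t => g (X t) (v t)) 2 unitMeasure := by
  refine MemLp.of_le_mul (c := |Cs|) hv ?_ (Eventually.of_forall fun t => hg.norm_apply_le _ _)
  exact (isBoundedBilinearMap_apply (𝕜 := ℝ) (E := V)
    (F := V →L[ℝ] ℝ)).continuous.comp_aestronglyMeasurable
    ((hg.continuous.comp_aestronglyMeasurable hX).prodMk hv.1)

end IsUniformMetric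

theorem integrable_apply {f : ℝ → V →L[ℝ] ℝ} {w : ℝ → V} (hf : MemLp f 2 unitMeasure)
    (hw : MemLp w 2 unitMeasure) : Integrable (fun t => f t (w t)) unitMeasure := by
  have hi : Integrable (fun t => ‖f t‖ * ‖w t‖) unitMeasure := hf.norm.integrable_mul hw.norm
  refine hi.mono' ?_ (Eventually.of_forall fun t => (f t).le_opNorm _)
  exact (isBoundedBilinearMap_apply (𝕜 := ℝ) (E := V) (F := ℝ)).continuous.comp_aestronglyMeasurable
    (hf.1.prodMk hw.1)

namespace IsUniformMetric

variable {g : Y → V →L[ℝ] V →L[ℝ] ℝ} {cs Cs : ℝ} {β : ℝ → ℝ}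

theorem integrable (hg : IsUniformMetric g cs Cs β) {X : ℝ → Y} {v w : ℝ → V}
    (hX : AEStronglyMeasurable X unitMeasure) (hv : MemLp v 2 unitMeasure)
    (hw : MemLp w 2 unitMeasure) : Integrable (fun t => g (X t) (v t) (w t)) unitMeasure :=
  integrable_apply (hg.memLp_apply hX hv) hw

theorem lintegral_eq (hg : IsUniformMetric g cs Cs β) {X : ℝ → Y} {v : ℝ → V}
    (hX : AEStronglyMeasurable X unitMeasure) (hv : MemLp v 2 unitMeasure) :
    ∫⁻ t, ENNReal.ofReal (g (X t) (v t) (v t)) ∂unitMeasure =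
      ENNReal.ofReal (∫ t, g (X t) (v t) (v t) ∂unitMeasure) :=
  (ofReal_integral_eq_lintegral_ofReal (hg.integrable hX hv hv)
    (Eventually.of_forall fun _ => hg.nonneg _ _)).symm

theorem integral_sq_le (hg : IsUniformMetric g cs Cs β) {X : ℝ → Y} {v : ℝ → V}
    (hX : AEStronglyMeasurable X unitMeasure) (hv : MemLp v 2 unitMeasure) :
    cs * ∫ t, ‖v t‖ ^ 2 ∂unitMeasure ≤ ∫ t, g (X t) (v t) (v t) ∂unitMeasure := by
  rw [← integral_const_mul]
  exact integral_mono (hv.norm.integrable_sq.const_mul _) (hg.integrable hX hv hv)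
    fun t => hg.coer _ _

/-- Moving the base points of a metric integral by at most `r` costs a factor `1 + β(r)/cs`. -/
theorem integral_le_of_dist_le (hg : IsUniformMetric g cs Cs β) {X Z : ℝ → Y} {v : ℝ → V} {r : ℝ}
    (hX : AEStronglyMeasurable X unitMeasure) (hZ : AEStronglyMeasurable Z unitMeasure)
    (hv : MemLp v 2 unitMeasure) (hr : ∀ t ∈ Ioo (0 : ℝ) 1, ‖Z t - X t‖ ≤ r) :
    ∫ t, g (Z t) (v t) (v t) ∂unitMeasure ≤
      (1 + β r / cs) * ∫ t, g (X t) (v t) (v t) ∂unitMeasure := by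
  rw [← integral_const_mul]
  refine integral_mono_ae (hg.integrable hZ hv hv) ((hg.integrable hX hv hv).const_mul _) ?_
  refine (ae_restrict_iff' measurableSet_Ioo).2 (Eventually.of_forall fun t ht => ?_)
  have hr0 : 0 ≤ r := (norm_nonneg _).trans (hr t ht)
  have hβ := hg.modulus.nonneg hr0
  have h1 := (abs_le.1 (hg.cont (Z t) (X t) (v t))).2
  have h2 : β ‖Z t - X t‖ * ‖v t‖ ^ 2 ≤ β r * ‖v t‖ ^ 2 :=
    mul_le_mul_of_nonneg_right (hg.modulus.mono (norm_nonneg _) (hr t ht)) (sq_nonneg _)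
  have h3 : β r * ‖v t‖ ^ 2 ≤ β r / cs * g (X t) (v t) (v t) := by
    rw [div_mul_eq_mul_div, le_div_iff₀ hg.pos]
    nlinarith [mul_le_mul_of_nonneg_left (hg.coer (X t) (v t)) hβ]
  show g (Z t) (v t) (v t) ≤ (1 + β r / cs) * g (X t) (v t) (v t)
  linarith

/-- Jensen's inequality for the quadratic form `g x`. -/
theorem apply_integral_le [CompleteSpace V] (hg : IsUniformMetric g cs Cs β) (x : Y) {v : ℝ → V}
    (hv : MemLp v 2 unitMeasure) :
    g x (∫ t, v t ∂unitMeasure) (∫ t, v t ∂unitMeasure) ≤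
      ∫ t, g x (v t) (v t) ∂unitMeasure := by
  set m := ∫ t, v t ∂unitMeasure with hm
  have hc : AEStronglyMeasurable (fun _ : ℝ => x) unitMeasure := aestronglyMeasurable_const
  have hmL : MemLp (fun _ : ℝ => m) 2 unitMeasure := memLp_const m
  have h0 : 0 ≤ ∫ t, g x (v t - m) (v t - m) ∂unitMeasure :=
    integral_nonneg fun t => hg.nonneg _ _
  have h1 : ∀ t, g x (v t - m) (v t - m) = g x (v t) (v t) - 2 * g x m (v t) + g x m m :=
    fun t => by
      simp only [map_sub, sub_apply, hg.symm x (v t) m]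
      ring
  simp only [h1] at h0
  have h2 : ∫ t, g x m (v t) ∂unitMeasure = g x m m :=
    (g x m).integral_comp_comm (hv.integrable one_le_two)
  have i1 := hg.integrable hc hv hv
  have i2 := (hg.integrable hc hmL hv).const_mul 2
  have i3 : Integrable (fun t => g x (v t) (v t) - 2 * g x m (v t)) unitMeasure := i1.sub i2
  rw [integral_add i3 (integrable_const _), integral_sub i1 i2, integral_const_mul, h2]
    at h0
  simp only [integral_const, probReal_univ, one_smul] at h0
  linarith

end IsUniformMetric

variable [NormedSpace ℝ Y]

theorem HasVelocity.continuousOn {ι : V →L[ℝ] Y} {x : ℝ → Y} {v : ℝ → V} (h : HasVelocity ι x v) :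
    ContinuousOn x (Icc 0 1) :=
  (continuousOn_const.add (ι.continuous.comp_continuousOn (continuousOn_primitive h.1))).congr h.2

theorem HasVelocity.aestronglyMeasurable {ι : V →L[ℝ] Y} {x : ℝ → Y} {v : ℝ → V}
    (h : HasVelocity ι x v) : AEStronglyMeasurable x unitMeasure :=
  (h.continuousOn.mono Ioo_subset_Icc_self).aestronglyMeasurable measurableSet_Ioo

theorem HasVelocity.sub {ι : V →L[ℝ] Y} {x y : ℝ → Y} {v w : ℝ → V} (hx : HasVelocity ι x v)
    (hy : HasVelocity ι y w) : HasVelocity ι (fun t => x t - y t) fun t => v t - w t := by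
  refine ⟨hx.1.sub hy.1, fun t ht => ?_⟩
  have h0 : (0 : ℝ) ∈ Icc (0 : ℝ) 1 := by simp
  beta_reduce
  rw [hx.2 t ht, hy.2 t ht, intervalIntegral.integral_sub
    (intervalIntegrable_of_integrable (hx.1.integrable one_le_two) h0 ht)
    (intervalIntegrable_of_integrable (hy.1.integrable one_le_two) h0 ht), map_sub]
  abel

theorem HasVelocity.sub_eq [CompleteSpace V] {ι : V →L[ℝ] Y} {x : ℝ → Y} {v : ℝ → V}
    (h : HasVelocity ι x v) {a b : ℝ} (ha : a ∈ Icc (0 : ℝ) 1) (hb : b ∈ Icc (0 : ℝ) 1) :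
    x b = x a + ι (∫ s in a..b, v s) := by
  have hi := h.1.integrable one_le_two
  have h0 : (0 : ℝ) ∈ Icc (0 : ℝ) 1 := by simp
  rw [h.2 b hb, h.2 a ha, ← intervalIntegral.integral_add_adjacent_intervals
    (intervalIntegrable_of_integrable hi h0 ha) (intervalIntegrable_of_integrable hi ha hb),
    map_add, add_assoc]

theorem HasVelocity.norm_sub_le [CompleteSpace V] {ι : V →L[ℝ] Y} {x : ℝ → Y} {v : ℝ → V}
    (h : HasVelocity ι x v) {a b : ℝ} (ha : a ∈ Icc (0 : ℝ) 1) (hb : b ∈ Icc (0 : ℝ) 1)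
    (hab : a ≤ b) :
    ‖x b - x a‖ ≤ ‖ι‖ * (√(b - a) * √(∫ s, ‖v s‖ ^ 2 ∂unitMeasure)) := by
  rw [h.sub_eq ha hb, add_sub_cancel_left]
  exact (ι.le_opNorm _).trans
    (mul_le_mul_of_nonneg_left (norm_integral_le_sqrt hab ha hb h.1) (norm_nonneg _))

theorem map_affine_unitMeasure {a b : ℝ} (hab : a < b) :
    unitMeasure.map (fun s => a + (b - a) * s) =
      ENNReal.ofReal |(b - a)⁻¹| • volume.restrict (Ioo a b) := by
  have hba : 0 < b - a := sub_pos.2 hab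
  have hpre : (fun s => a + (b - a) * s) ⁻¹' Ioo a b = Ioo 0 1 := by
    ext s
    simp only [mem_preimage, mem_Ioo]
    constructor
    · rintro ⟨h1, h2⟩
      exact ⟨by nlinarith, by nlinarith⟩
    · rintro ⟨h1, h2⟩
      exact ⟨by nlinarith, by nlinarith⟩
  rw [unitMeasure, ← hpre, ← Measure.restrict_map (by fun_prop) measurableSet_Ioo]
  have : (volume : Measure ℝ).map (fun s => a + (b - a) * s) =
      ENNReal.ofReal |(b - a)⁻¹| • volume := by
    rw [show (fun s => a + (b - a) * s) = (fun s => a + s) ∘ fun s => (b - a) * s from rfl,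
      ← Measure.map_map (by fun_prop) (by fun_prop), Real.map_volume_mul_left hba.ne',
      Measure.map_smul, map_add_left_eq_self]
  rw [this, Measure.restrict_smul]

/-- Reparametrising the piece of a path over `[a, b]` to `[0, 1]` multiplies the velocity by
`b - a`. -/
theorem HasVelocity.comp_affine [CompleteSpace V] {ι : V →L[ℝ] Y} {x : ℝ → Y} {v : ℝ → V}
    (h : HasVelocity ι x v) {a b : ℝ} (ha : a ∈ Icc (0 : ℝ) 1) (hb : b ∈ Icc (0 : ℝ) 1)
    (hab : a < b) :
    HasVelocity ι (fun s => x (a + (b - a) * s)) fun s => (b - a) • v (a + (b - a) * s) := by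
  have hba : 0 < b - a := sub_pos.2 hab
  constructor
  · have h1 : MemLp v 2 (unitMeasure.map (fun s => a + (b - a) * s)) := by
      rw [map_affine_unitMeasure hab]
      exact (h.1.mono_measure
        (Measure.restrict_mono (Ioo_subset_Ioo ha.1 hb.2) le_rfl)).smul_measure ENNReal.ofReal_ne_top
    exact (h1.comp_of_map (by fun_prop)).const_smul _
  · intro t ht
    have ht' : a + (b - a) * t ∈ Icc (0 : ℝ) 1 :=
      ⟨by nlinarith [ha.1, ht.1], by nlinarith [hb.2, ht.2]⟩
    simp only [mul_zero, add_zero]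
    rw [h.sub_eq ha ht', intervalIntegral.integral_smul,
      intervalIntegral.integral_comp_add_mul _ hba.ne', smul_smul, mul_inv_cancel₀ hba.ne',
      one_smul, mul_zero, add_zero]

theorem pathEnergy_le {ι : V →L[ℝ] Y} {g : Y → V →L[ℝ] V →L[ℝ] ℝ} {cs Cs : ℝ} {β : ℝ → ℝ}
    (hg : IsUniformMetric g cs Cs β) {x : ℝ → Y} {v : ℝ → V} (h : HasVelocity ι x v) :
    pathEnergy ι g x ≤ ENNReal.ofReal (∫ t, g (x t) (v t) (v t) ∂unitMeasure) :=
  (iInf₂_le v h).trans (hg.lintegral_eq h.aestronglyMeasurable h.1).le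

theorem riemDist_le_sqrt {ι : V →L[ℝ] Y} {g : Y → V →L[ℝ] V →L[ℝ] ℝ} {cs Cs : ℝ} {β : ℝ → ℝ}
    (hg : IsUniformMetric g cs Cs β) {x : ℝ → Y} {v : ℝ → V} (h : HasVelocity ι x v) :
    riemDist ι g (x 0) (x 1) ≤ ENNReal.ofReal √(∫ t, g (x t) (v t) (v t) ∂unitMeasure) := by
  have hE : 0 ≤ ∫ t, g (x t) (v t) (v t) ∂unitMeasure := integral_nonneg fun _ => hg.nonneg _ _
  rw [Real.sqrt_eq_rpow, ← ENNReal.ofReal_rpow_of_nonneg hE (by norm_num), riemDist]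
  gcongr
  exact le_trans (iInf_le_of_le x (iInf₂_le_of_le rfl rfl le_rfl)) (pathEnergy_le hg h)

/-- The distance of two points of a path is controlled by the energy of the piece between them. -/
theorem riemDist_le_of_hasVelocity [CompleteSpace V] {ι : V →L[ℝ] Y}
    {g : Y → V →L[ℝ] V →L[ℝ] ℝ} {cs Cs : ℝ} {β : ℝ → ℝ} (hg : IsUniformMetric g cs Cs β)
    {x : ℝ → Y} {v : ℝ → V} (h : HasVelocity ι x v) {a b : ℝ} (ha : a ∈ Icc (0 : ℝ) 1)
    (hb : b ∈ Icc (0 : ℝ) 1) (hab : a < b) :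
    riemDist ι g (x a) (x b) ≤
      ENNReal.ofReal √((b - a) * ∫ t in a..b, g (x t) (v t) (v t)) := by
  have hba : 0 < b - a := sub_pos.2 hab
  have := riemDist_le_sqrt hg (h.comp_affine ha hb hab)
  simp only [mul_zero, add_zero, mul_one, add_sub_cancel, map_smul,
    smul_apply, smul_eq_mul] at this
  rw [integral_unitMeasure, intervalIntegral.integral_const_mul,
    intervalIntegral.integral_const_mul, intervalIntegral.integral_comp_add_mul
      (fun t => g (x t) (v t) (v t)) hba.ne', smul_eq_mul, mul_inv_cancel_left₀ hba.ne'] at this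
  simpa using this

theorem riemDist_ne_top [CompleteSpace V] {ι : V →L[ℝ] Y} {g : Y → V →L[ℝ] V →L[ℝ] ℝ}
    {cs Cs : ℝ} {β : ℝ → ℝ} (hg : IsUniformMetric g cs Cs β) (x : Y) (u : V) :
    riemDist ι g x (x + ι u) ≠ ⊤ := by
  have h : HasVelocity ι (fun t : ℝ => x + ι (t • u)) fun _ => u :=
    ⟨memLp_const u, fun t _ => by simp⟩
  have := riemDist_le_sqrt hg h
  simp only [zero_smul, one_smul, map_zero, add_zero] at this
  exact ne_top_of_le_ne_top ENNReal.ofReal_ne_top this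

theorem toReal_riemDist_sq {ι : V →L[ℝ] Y} {g : Y → V →L[ℝ] V →L[ℝ] ℝ} {x y : Y} :
    (riemDist ι g x y).toReal ^ 2 =
      (⨅ (p : ℝ → Y) (_ : p 0 = x) (_ : p 1 = y), pathEnergy ι g p).toReal := by
  rw [riemDist, ← ENNReal.toReal_pow, ← ENNReal.rpow_natCast, ← ENNReal.rpow_mul]
  norm_num

/-- A path with energy at most `R²` stays in the ball of radius `‖ι‖ R / √cs` in `Y`; there the
metric is nearly constant, so that straight lines are nearly optimal. -/
theorem apply_le_energy [CompleteSpace V] {ι : V →L[ℝ] Y} (hι : Function.Injective ι)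
    {g : Y → V →L[ℝ] V →L[ℝ] ℝ} {cs Cs : ℝ} {β : ℝ → ℝ} (hg : IsUniformMetric g cs Cs β)
    {p : ℝ → Y} {w : ℝ → V} (h : HasVelocity ι p w) {u : V} (hu : p 1 = p 0 + ι u) {R : ℝ}
    (hR : 0 ≤ R) (hE : ∫ t, g (p t) (w t) (w t) ∂unitMeasure ≤ R ^ 2) :
    g (p 0) u u ≤
      (1 + β (‖ι‖ * (R / √cs)) / cs) * ∫ t, g (p t) (w t) (w t) ∂unitMeasure := by
  have hw : ∫ t, w t ∂unitMeasure = u := by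
    have := h.2 1 (by simp)
    rw [hu, add_right_inj] at this
    rw [integral_unitMeasure, hι this]
  have hsq : √(∫ t, ‖w t‖ ^ 2 ∂unitMeasure) ≤ R / √cs := by
    rw [← Real.sqrt_sq hR, ← Real.sqrt_div (sq_nonneg R)]
    refine Real.sqrt_le_sqrt ?_
    rw [le_div_iff₀ hg.pos, mul_comm]
    exact (hg.integral_sq_le h.aestronglyMeasurable h.1).trans hE
  rw [← hw]
  refine (hg.apply_integral_le (p 0) h.1).trans ?_
  refine hg.integral_le_of_dist_le h.aestronglyMeasurable aestronglyMeasurable_const h.1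
    fun t ht => ?_
  rw [norm_sub_rev]
  refine (h.norm_sub_le (a := 0) (by simp) ⟨ht.1.le, ht.2.le⟩ ht.1.le).trans ?_
  refine mul_le_mul_of_nonneg_left ?_ (norm_nonneg _)
  refine (mul_le_of_le_one_left (Real.sqrt_nonneg _) ?_).trans hsq
  rw [Real.sqrt_le_iff]
  refine ⟨zero_le_one, ?_⟩
  linarith [ht.2]

/-- A lower bound for the distance to `x + ι u`: the square length of `u` in the metric at `x`, up
to a factor tending to `1` as the distance tends to `0`. -/
theorem apply_le_riemDist_sq [CompleteSpace V] {ι : V →L[ℝ] Y} (hι : Function.Injective ι)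
    {g : Y → V →L[ℝ] V →L[ℝ] ℝ} {cs Cs : ℝ} {β : ℝ → ℝ} (hg : IsUniformMetric g cs Cs β)
    (x : Y) (u : V) {R : ℝ} (hR : (riemDist ι g x (x + ι u)).toReal < R) :
    g x u u ≤
      (1 + β (‖ι‖ * (R / √cs)) / cs) * (riemDist ι g x (x + ι u)).toReal ^ 2 := by
  have hR0 : 0 ≤ R := ENNReal.toReal_nonneg.trans hR.le
  set B := 1 + β (‖ι‖ * (R / √cs)) / cs
  have hB : 0 < B := by
    have := hg.modulus.nonneg (r := ‖ι‖ * (R / √cs)) (by positivity)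
    have := div_nonneg this hg.pos.le
    positivity
  by_contra! hlt
  have hsq : (riemDist ι g x (x + ι u)).toReal ^ 2 < R ^ 2 :=
    pow_lt_pow_left₀ hR ENNReal.toReal_nonneg two_ne_zero
  have hlt' : (riemDist ι g x (x + ι u)).toReal ^ 2 < g x u u / B := by
    rwa [lt_div_iff₀ hB, mul_comm]
  obtain ⟨e, he, he'⟩ := exists_between (lt_min hsq hlt')
  obtain ⟨he1, he2⟩ := lt_min_iff.1 he'
  have htop : (⨅ (p : ℝ → Y) (_ : p 0 = x) (_ : p 1 = x + ι u), pathEnergy ι g p) ≠ ⊤ := by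
    intro htop
    have := riemDist_ne_top (ι := ι) hg x u
    rw [riemDist, htop, ENNReal.top_rpow_of_pos (by norm_num)] at this
    exact this rfl
  have he0 : 0 < e := (sq_nonneg _).trans_lt he
  rw [toReal_riemDist_sq, ← ENNReal.lt_ofReal_iff_toReal_lt htop] at he
  simp only [iInf_lt_iff, pathEnergy] at he
  obtain ⟨p, hp0, hp1, w, hw, hlt⟩ := he
  rw [hg.lintegral_eq hw.aestronglyMeasurable hw.1, ENNReal.ofReal_lt_ofReal_iff he0] at hlt
  have := apply_le_energy hι hg hw (u := u) (by rw [hp1, hp0]) hR0 (hlt.le.trans he1.le)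
  rw [hp0] at this
  rw [lt_div_iff₀ hB] at he2
  nlinarith

end Metric

/-! ### Weak and uniform convergence of paths -/

section WeakConvergence

variable {Y V : Type*} [NormedAddCommGroup Y] [NormedSpace ℝ Y]
  [NormedAddCommGroup V] [NormedSpace ℝ V]

/-- If `V` is reflexive and embedded in `Y`, the functionals that extend to `Y` are dense in the
dual of `V`: by Hahn–Banach, otherwise some `v ≠ 0` would be annihilated by all of them. -/
theorem exists_comp_near
    (hrefl : Function.Surjective (NormedSpace.inclusionInDoubleDual ℝ V))
    {ι : V →L[ℝ] Y} (hι : Function.Injective ι) (l : V →L[ℝ] ℝ) {ε : ℝ} (hε : 0 < ε) :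
    ∃ y : Y →L[ℝ] ℝ, ‖l - y.comp ι‖ < ε := by
  let S : Submodule ℝ (V →L[ℝ] ℝ) :=
    LinearMap.range ((ContinuousLinearMap.compL ℝ V Y ℝ).flip ι).toLinearMap
  by_cases hl : l ∈ S.topologicalClosure
  · rw [← SetLike.mem_coe, Submodule.topologicalClosure_coe, Metric.mem_closure_iff] at hl
    obtain ⟨_, ⟨y, rfl⟩, hy⟩ := hl ε hε
    exact ⟨y, by simpa [dist_eq_norm] using hy⟩
  · exfalso
    obtain ⟨f, u, hfu, hul⟩ := geometric_hahn_banach_closed_point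
      S.topologicalClosure.convex S.isClosed_topologicalClosure hl
    have hu : 0 < u := by simpa using hfu 0 (zero_mem _)
    have hf : ∀ y : Y →L[ℝ] ℝ, f (y.comp ι) = 0 := fun y => by
      by_contra hne
      have hm : (u / f (y.comp ι)) • y.comp ι ∈ S.topologicalClosure :=
        S.le_topologicalClosure (S.smul_mem _ ⟨y, rfl⟩)
      have := hfu _ hm
      rw [map_smul, smul_eq_mul, div_mul_cancel₀ _ hne] at this
      exact lt_irrefl _ this
    obtain ⟨v, rfl⟩ := hrefl f
    have hv : ι v = 0 := SeparatingDual.eq_zero_of_forall_dual_eq_zero (R := ℝ) fun y => by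
      simpa using hf y
    have hv0 : v = 0 := hι (by simpa using hv)
    simp only [hv0, map_zero, zero_apply] at hul
    exact lt_asymm hu hul

theorem tendsto_apply_of_tendsto_embedding
    (hrefl : Function.Surjective (NormedSpace.inclusionInDoubleDual ℝ V))
    {ι : V →L[ℝ] Y} (hι : Function.Injective ι) {α : Type*} {F : Filter α} {U : α → V} {M : ℝ}
    (hM : ∀ᶠ n in F, ‖U n‖ ≤ M) (hU : Tendsto (fun n => ι (U n)) F (𝓝 0)) (l : V →L[ℝ] ℝ) :
    Tendsto (fun n => l (U n)) F (𝓝 0) := by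
  rw [Metric.tendsto_nhds]
  intro ε hε
  obtain ⟨y, hy⟩ := exists_comp_near hrefl hι l (ε := ε / 2 / (|M| + 1)) (by positivity)
  have h1 : Tendsto (fun n => y (ι (U n))) F (𝓝 0) := by
    have := (y.continuous.tendsto 0).comp hU
    rwa [map_zero] at this
  filter_upwards [hM, (Metric.tendsto_nhds.1 h1) (ε / 2) (by positivity)] with n hn h2
  rw [dist_zero_right] at h2 ⊢
  have h3 : ‖(l - y.comp ι) (U n)‖ ≤ ε / 2 / (|M| + 1) * (|M| + 1) :=
    (ContinuousLinearMap.le_opNorm _ _).trans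
      (mul_le_mul hy.le (by linarith [le_abs_self M]) (norm_nonneg _) (by positivity))
  rw [div_mul_cancel₀ _ (by positivity)] at h3
  calc ‖l (U n)‖ = ‖(l - y.comp ι) (U n) + y (ι (U n))‖ := by simp
    _ ≤ _ := norm_add_le _ _
    _ < ε := by linarith

/-- Step functions on uniform grids are dense in `L²`. -/
theorem exists_step_near {E : Type*} [NormedAddCommGroup E] [NormedSpace ℝ E] {f : ℝ → E}
    (hf : MemLp f 2 unitMeasure) {ε : ℝ} (hε : 0 < ε) :
    ∃ (N : ℕ) (H : ℕ → E), 1 ≤ N ∧ ∫ t, ‖f t - H ⌊(N : ℝ) * t⌋₊‖ ^ 2 ∂unitMeasure ≤ ε := by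
  have : unitMeasure.Regular := by unfold unitMeasure; infer_instance
  have hf' : MemLp f (ENNReal.ofReal 2) unitMeasure := by simpa using hf
  obtain ⟨h, hsupp, hle, hcont, hmem⟩ :=
    hf'.exists_hasCompactSupport_integral_rpow_sub_le (by norm_num) (ε := ε / 4) (by positivity)
  have hmem' : MemLp h 2 unitMeasure := by simpa using hmem
  simp only [Real.rpow_ofNat] at hle
  have huc : UniformContinuous h := hsupp.uniformContinuous_of_continuous hcont
  obtain ⟨δ, hδ, hδh⟩ := Metric.uniformContinuous_iff.1 huc (√(ε / 4)) (by positivity)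
  obtain ⟨n, hn⟩ := exists_nat_one_div_lt hδ
  set N := n + 1 with hN
  have hN0 : (0 : ℝ) < N := by positivity
  refine ⟨N, fun k => h ((k : ℝ) / N), by omega, ?_⟩
  have hstep : MemLp (fun t : ℝ => h ((⌊(N : ℝ) * t⌋₊ : ℝ) / N)) 2 unitMeasure :=
    memLp_step N (fun k => h ((k : ℝ) / N)) 2
  have hpt : ∀ t ∈ Ioo (0 : ℝ) 1,
      ‖f t - h ((⌊(N : ℝ) * t⌋₊ : ℝ) / N)‖ ^ 2 ≤ 2 * ‖f t - h t‖ ^ 2 + ε / 2 := fun t ht => by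
    have hd : dist t ((⌊(N : ℝ) * t⌋₊ : ℝ) / N) < δ := by
      have h1 := Nat.floor_le (mul_nonneg hN0.le ht.1.le)
      have h2 := Nat.lt_floor_add_one ((N : ℝ) * t)
      have h3 : t - (⌊(N : ℝ) * t⌋₊ : ℝ) / N = (N * t - (⌊(N : ℝ) * t⌋₊ : ℝ)) / N := by
        field_simp
      rw [Real.dist_eq, h3, abs_of_nonneg (div_nonneg (by linarith) hN0.le)]
      refine lt_of_le_of_lt ?_ hn
      rw [hN]; push_cast
      gcongr
      rw [hN] at h2; push_cast at h2
      linarith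
    have h4 : ‖h t - h ((⌊(N : ℝ) * t⌋₊ : ℝ) / N)‖ ^ 2 ≤ ε / 4 := by
      have := (hδh hd).le
      rw [dist_eq_norm] at this
      exact (Real.le_sqrt (norm_nonneg _) (by positivity)).1 this
    have h5 : ‖f t - h ((⌊(N : ℝ) * t⌋₊ : ℝ) / N)‖ ≤
        ‖f t - h t‖ + ‖h t - h ((⌊(N : ℝ) * t⌋₊ : ℝ) / N)‖ :=
      norm_sub_le_norm_sub_add_norm_sub _ _ _
    have h6 := pow_le_pow_left₀ (norm_nonneg _) h5 2
    nlinarith [sq_nonneg (‖f t - h t‖ - ‖h t - h ((⌊(N : ℝ) * t⌋₊ : ℝ) / N)‖)]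
  have i1 : Integrable (fun t => ‖f t - h t‖ ^ 2) unitMeasure := (hf.sub hmem').norm.integrable_sq
  calc ∫ t, ‖f t - h ((⌊(N : ℝ) * t⌋₊ : ℝ) / N)‖ ^ 2 ∂unitMeasure
      ≤ ∫ t, (2 * ‖f t - h t‖ ^ 2 + ε / 2) ∂unitMeasure :=
        integral_mono_ae (hf.sub hstep).norm.integrable_sq
          ((i1.const_mul 2).add (integrable_const _))
          ((ae_restrict_iff' measurableSet_Ioo).2 (Eventually.of_forall hpt))
    _ = 2 * ∫ t, ‖f t - h t‖ ^ 2 ∂unitMeasure + ε / 2 := by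
        rw [integral_add (i1.const_mul 2) (integrable_const _), integral_const_mul]
        simp
    _ ≤ ε := by linarith

theorem integral_step_apply [CompleteSpace V] {N : ℕ} (hN : 1 ≤ N) (H : ℕ → V →L[ℝ] ℝ)
    {w : ℝ → V} (hw : MemLp w 2 unitMeasure) :
    ∫ t, H ⌊(N : ℝ) * t⌋₊ (w t) ∂unitMeasure = ∑ k ∈ Finset.range N,
      (H k (∫ s in (0 : ℝ)..(((k + 1 : ℕ) : ℝ) / N), w s) -
        H k (∫ s in (0 : ℝ)..((k : ℝ) / N), w s)) := by
  have hN' : (N : ℝ) ≠ 0 := by exact_mod_cast (by omega : N ≠ 0)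
  have hi := hw.integrable one_le_two
  have h := sum_integral_grid hN (integrable_apply (memLp_step N H 2) hw) le_rfl
  rw [div_self hN', ← integral_unitMeasure] at h
  rw [← h]
  refine Finset.sum_congr rfl fun k hk => ?_
  have hk := Finset.mem_range.1 hk
  have h0 : (0 : ℝ) ∈ Icc (0 : ℝ) 1 := by simp
  have m1 := grid_mem (n := k) hN (by omega)
  have m2 := grid_mem (n := k + 1) hN (by omega)
  rw [← map_sub, intervalIntegral.integral_interval_sub_left
    (intervalIntegrable_of_integrable hi h0 m2) (intervalIntegrable_of_integrable hi h0 m1),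
    ← (H k).intervalIntegral_comp_comm (intervalIntegrable_of_integrable hi m1 m2)]
  refine intervalIntegral.integral_congr_Ioo_of_le (grid_le_succ k) fun s hs => ?_
  simp only [floor_eq_of_mem_cell hN k ⟨hs.1.le, hs.2⟩]

theorem tendsto_integral_step_apply [CompleteSpace V]
    (hrefl : Function.Surjective (NormedSpace.inclusionInDoubleDual ℝ V))
    {ι : V →L[ℝ] Y} (hι : Function.Injective ι) {w : ℕ → ℝ → V} {M : ℝ}
    (hw : ∀ n, MemLp (w n) 2 unitMeasure)
    (hM : ∀ᶠ n in atTop, ∫ t, ‖w n t‖ ^ 2 ∂unitMeasure ≤ M)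
    (hz : ∀ t ∈ Icc (0 : ℝ) 1, Tendsto (fun n => ι (∫ s in (0 : ℝ)..t, w n s)) atTop (𝓝 0))
    {N : ℕ} (hN : 1 ≤ N) (H : ℕ → V →L[ℝ] ℝ) :
    Tendsto (fun n => ∫ t, H ⌊(N : ℝ) * t⌋₊ (w n t) ∂unitMeasure) atTop (𝓝 0) := by
  have hweak : ∀ t ∈ Icc (0 : ℝ) 1, ∀ l : V →L[ℝ] ℝ,
      Tendsto (fun n => l (∫ s in (0 : ℝ)..t, w n s)) atTop (𝓝 0) := fun t ht l => by
    refine tendsto_apply_of_tendsto_embedding hrefl hι (M := √M) ?_ (hz t ht) l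
    filter_upwards [hM] with n hn
    refine (norm_integral_le_sqrt ht.1 (by simp) ht (hw n)).trans ?_
    refine (mul_le_of_le_one_left (Real.sqrt_nonneg _) ?_).trans (Real.sqrt_le_sqrt hn)
    rw [Real.sqrt_le_iff]
    exact ⟨zero_le_one, by linarith [ht.2]⟩
  have hsum : Tendsto (fun n => ∑ k ∈ Finset.range N,
      (H k (∫ s in (0 : ℝ)..(((k + 1 : ℕ) : ℝ) / N), w n s) -
        H k (∫ s in (0 : ℝ)..((k : ℝ) / N), w n s))) atTop
      (𝓝 (∑ _k ∈ Finset.range N, (0 - 0 : ℝ))) := by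
    refine tendsto_finsetSum _ fun k hk => ?_
    have hk := Finset.mem_range.1 hk
    exact (hweak _ (grid_mem (n := k + 1) hN (by omega)) (H k)).sub
      (hweak _ (grid_mem (n := k) hN (by omega)) (H k))
  simp only [sub_zero, Finset.sum_const_zero] at hsum
  exact hsum.congr fun n => (integral_step_apply hN H (hw n)).symm

/-- Velocities bounded in `L²((0,1); V)` whose primitives tend to `0` pointwise in `Y` tend to `0`
weakly in `L²((0,1); V)`. -/
theorem tendsto_integral_apply [CompleteSpace V]
    (hrefl : Function.Surjective (NormedSpace.inclusionInDoubleDual ℝ V))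
    {ι : V →L[ℝ] Y} (hι : Function.Injective ι) {w : ℕ → ℝ → V} {M : ℝ}
    (hw : ∀ n, MemLp (w n) 2 unitMeasure)
    (hM : ∀ᶠ n in atTop, ∫ t, ‖w n t‖ ^ 2 ∂unitMeasure ≤ M)
    (hz : ∀ t ∈ Icc (0 : ℝ) 1, Tendsto (fun n => ι (∫ s in (0 : ℝ)..t, w n s)) atTop (𝓝 0))
    {f : ℝ → V →L[ℝ] ℝ} (hf : MemLp f 2 unitMeasure) :
    Tendsto (fun n => ∫ t, f t (w n t) ∂unitMeasure) atTop (𝓝 0) := by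
  rw [Metric.tendsto_nhds]
  intro ε hε
  set e := ε / (|M| + 2) with he
  have he0 : 0 < e := by positivity
  obtain ⟨N, H, hN, hH⟩ := exists_step_near hf (ε := e ^ 2) (by positivity)
  have hstep := tendsto_integral_step_apply hrefl hι hw hM hz hN H
  filter_upwards [hM, (Metric.tendsto_nhds.1 hstep) (e / 2) (by positivity)] with n hn h1
  rw [dist_zero_right] at h1 ⊢
  have hHm := memLp_step N H 2
  have hd : MemLp (fun t => f t - H ⌊(N : ℝ) * t⌋₊) 2 unitMeasure := hf.sub hHm
  have i1 := integrable_apply hd (hw n)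
  have i2 := integrable_apply hHm (hw n)
  have hsplit : ∫ t, f t (w n t) ∂unitMeasure =
      ∫ t, (f t - H ⌊(N : ℝ) * t⌋₊) (w n t) ∂unitMeasure +
        ∫ t, H ⌊(N : ℝ) * t⌋₊ (w n t) ∂unitMeasure := by
    rw [← integral_add i1 i2]
    simp
  -- Young's inequality with weight `e`, as the first factor has square integral at most `e²`
  have hyoung : ∀ t, ‖(f t - H ⌊(N : ℝ) * t⌋₊) (w n t)‖ ≤
      (1 / (2 * e)) * ‖f t - H ⌊(N : ℝ) * t⌋₊‖ ^ 2 + e / 2 * ‖w n t‖ ^ 2 := fun t => by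
    refine (ContinuousLinearMap.le_opNorm _ _).trans ?_
    set a := ‖f t - H ⌊(N : ℝ) * t⌋₊‖
    set b := ‖w n t‖
    have : 1 / (2 * e) * a ^ 2 + e / 2 * b ^ 2 - a * b = (a - e * b) ^ 2 / (2 * e) := by
      field_simp; ring
    have h0 : 0 ≤ (a - e * b) ^ 2 / (2 * e) := by positivity
    linarith
  have j1 := hd.norm.integrable_sq
  have j2 := (hw n).norm.integrable_sq
  have h2 : ‖∫ t, (f t - H ⌊(N : ℝ) * t⌋₊) (w n t) ∂unitMeasure‖ ≤ e / 2 + e / 2 * |M| := by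
    refine (norm_integral_le_integral_norm _).trans ((integral_mono i1.norm
      ((j1.const_mul _).add (j2.const_mul _)) hyoung).trans ?_)
    simp only [Pi.add_apply]
    rw [integral_add (j1.const_mul _) (j2.const_mul _), integral_const_mul, integral_const_mul]
    have a1 : 1 / (2 * e) * ∫ t, ‖f t - H ⌊(N : ℝ) * t⌋₊‖ ^ 2 ∂unitMeasure ≤ e / 2 := by
      refine (mul_le_mul_of_nonneg_left hH (by positivity)).trans (le_of_eq ?_)
      field_simp
    have a2 : e / 2 * ∫ t, ‖w n t‖ ^ 2 ∂unitMeasure ≤ e / 2 * |M| :=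
      mul_le_mul_of_nonneg_left (hn.trans (le_abs_self M)) (by positivity)
    linarith
  rw [hsplit]
  refine (norm_add_le _ _).trans_lt ?_
  have h3 : e * (|M| + 2) = ε := by rw [he]; field_simp
  nlinarith [abs_nonneg M]

/-- Paths with velocities bounded in `L²((0,1); V)` are equicontinuous in `Y`, so that `L²`
convergence to zero is uniform. -/
theorem eventually_norm_le_of_tendsto [CompleteSpace V] {ι : V →L[ℝ] Y} {z : ℕ → ℝ → Y}
    {w : ℕ → ℝ → V} {M : ℝ} (hz : ∀ᶠ n in atTop, HasVelocity ι (z n) (w n))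
    (hM : ∀ᶠ n in atTop, ∫ t, ‖w n t‖ ^ 2 ∂unitMeasure ≤ M)
    (hconv : Tendsto (fun n => eLpNorm (z n) 2 unitMeasure) atTop (𝓝 0)) {ε : ℝ} (hε : 0 < ε) :
    ∀ᶠ n in atTop, ∀ t ∈ Icc (0 : ℝ) 1, ‖z n t‖ ≤ ε := by
  set L := ‖ι‖ * √M with hL
  have hL0 : 0 ≤ L := by positivity
  set η := min (1 / 2) ((ε / (2 * (L + 1))) ^ 2) with hη
  have hη0 : 0 < η := lt_min (by norm_num) (by positivity)
  have hη1 : η ≤ 1 / 2 := min_le_left _ _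
  have hηL : L * √η ≤ ε / 2 := by
    have h1 : √η ≤ ε / (2 * (L + 1)) := by
      rw [← Real.sqrt_sq (show 0 ≤ ε / (2 * (L + 1)) by positivity)]
      exact Real.sqrt_le_sqrt (min_le_right _ _)
    calc L * √η ≤ (L + 1) * (ε / (2 * (L + 1))) :=
          mul_le_mul (by linarith) h1 (Real.sqrt_nonneg _) (by positivity)
      _ = ε / 2 := by field_simp
  have hsmall := ENNReal.Tendsto.pow (n := 2) hconv
  rw [zero_pow two_ne_zero] at hsmall
  have hev := hsmall.eventually_lt_const
    (show (0 : ℝ≥0∞) < ENNReal.ofReal (ε / 2) ^ 2 * ENNReal.ofReal η from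
      ENNReal.mul_pos (pow_ne_zero _ (by simpa using hε)) (by simpa using hη0))
  filter_upwards [hz, hM, hev] with n hzn hMn hn t ht
  by_contra! hlt
  have hholder : ∀ a ∈ Icc (0 : ℝ) 1, ∀ b ∈ Icc (0 : ℝ) 1, a ≤ b → b - a ≤ η →
      ‖z n b - z n a‖ ≤ ε / 2 := fun a ha b hb hab hba => by
    refine (hzn.norm_sub_le ha hb hab).trans (le_trans ?_ hηL)
    calc ‖ι‖ * (√(b - a) * √(∫ s, ‖w n s‖ ^ 2 ∂unitMeasure)) ≤ ‖ι‖ * (√η * √M) := by gcongr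
      _ = L * √η := by rw [hL]; ring
  -- the norm exceeds `ε / 2` on an interval of length `η` next to `t`
  obtain ⟨a, ha0, ha1, hJ⟩ : ∃ a, 0 ≤ a ∧ a + η ≤ 1 ∧ ∀ s ∈ Ioo a (a + η), ε / 2 ≤ ‖z n s‖ := by
    rcases le_total t (1 / 2) with h | h
    · refine ⟨t, ht.1, by linarith, fun s hs => ?_⟩
      have h1 := hholder t ht s ⟨by linarith [ht.1, hs.1], by linarith [hs.2]⟩ hs.1.le
        (by linarith [hs.2])
      rw [norm_sub_rev] at h1
      linarith [norm_sub_norm_le (z n t) (z n s)]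
    · refine ⟨t - η, by linarith, by linarith [ht.2], fun s hs => ?_⟩
      have h1 := hholder s ⟨by linarith [hs.1], by linarith [hs.2, ht.2]⟩ t ht
        (by linarith [hs.2]) (by linarith [hs.1])
      linarith [norm_sub_norm_le (z n t) (z n s)]
  have hcheb := mul_meas_ge_le_pow_eLpNorm' unitMeasure two_ne_zero ENNReal.ofNat_ne_top
    hzn.aestronglyMeasurable (ENNReal.ofReal (ε / 2))
  have hvol : ENNReal.ofReal η ≤ unitMeasure {s | ENNReal.ofReal (ε / 2) ≤ ‖z n s‖ₑ} := by
    calc ENNReal.ofReal η = unitMeasure (Ioo a (a + η)) := by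
          rw [unitMeasure, Measure.restrict_apply measurableSet_Ioo,
            inter_eq_left.2 (Ioo_subset_Ioo ha0 ha1), Real.volume_Ioo, add_sub_cancel_left]
      _ ≤ _ := measure_mono fun s hs => by
          rw [mem_ofPred_eq, ← ofReal_norm]
          exact ENNReal.ofReal_le_ofReal (hJ s hs)
  norm_num at hcheb
  exact absurd hn (not_lt.2 ((mul_le_mul_right hvol _).trans hcheb))

end WeakConvergence

/-! ### Energy bounds for discrete geodesics -/

section DiscreteEnergy

theorem discreteEnergy_eq_coe {Y : Type*} {W : Y → Y → EReal} {K : ℕ} {y : ℕ → Y}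
    (hbot : ∀ x y, W x y ≠ ⊥) (htop : ∀ k < K, W (y k) (y (k + 1)) ≠ ⊤) :
    discreteEnergy W K y =
      (((K : ℝ) * ∑ k ∈ Finset.range K, (W (y k) (y (k + 1))).toReal : ℝ) : EReal) := by
  have h : ∀ s : Finset ℕ, ((∑ k ∈ s, (W (y k) (y (k + 1))).toReal : ℝ) : EReal) =
      ∑ k ∈ s, (((W (y k) (y (k + 1))).toReal : ℝ) : EReal) := fun s => by
    induction s using Finset.induction_on with
    | empty => simp
    | insert a s ha ih => rw [Finset.sum_insert ha, Finset.sum_insert ha, EReal.coe_add, ih]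
  rw [discreteEnergy, EReal.coe_mul, h]
  congr 1
  exact Finset.sum_congr rfl fun k hk =>
    (EReal.coe_toReal (htop k (Finset.mem_range.1 hk)) (hbot _ _)).symm

theorem integral_step_energy {Y V : Type*} [NormedAddCommGroup V] [NormedSpace ℝ V]
    (g : Y → V →L[ℝ] V →L[ℝ] ℝ) {K : ℕ} (hK : 1 ≤ K) (y : ℕ → Y)
    (c : ℕ → V) :
    ∫ t, g (y ⌊(K : ℝ) * t⌋₊) (stepVel K c t) (stepVel K c t) ∂unitMeasure =
      (K : ℝ) * ∑ k ∈ Finset.range K, g (y k) (c (k + 1) - c k) (c (k + 1) - c k) := by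
  have hK' : (K : ℝ) ≠ 0 := by exact_mod_cast (by omega : K ≠ 0)
  have := integral_unitMeasure_step hK fun k =>
    g (y k) ((K : ℝ) • (c (k + 1) - c k)) ((K : ℝ) • (c (k + 1) - c k))
  simp only [stepVel]
  rw [this, smul_eq_mul, Finset.mul_sum, Finset.mul_sum]
  refine Finset.sum_congr rfl fun k _ => ?_
  simp only [map_smul, smul_apply, smul_eq_mul]
  field_simp

variable {Y V : Type*} [NormedAddCommGroup Y] [NormedSpace ℝ Y]
  [NormedAddCommGroup V] [NormedSpace ℝ V] [CompleteSpace V] {ι : V →L[ℝ] Y}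
  {g : Y → V →L[ℝ] V →L[ℝ] ℝ} {cs Cs : ℝ} {β : ℝ → ℝ} {W : Y → Y → EReal}

/-- The recovery sequence: sampling a path at the grid points gives a discrete energy that exceeds
the energy of the path by `O(K^{-1/2})` at most. -/
theorem sampled_energy_le (hg : IsUniformMetric g cs Cs β) {C δ : ℝ}
    (hW : ∀ x y, riemDist ι g x y ≤ ENNReal.ofReal δ → W x y ≠ ⊤ ∧
      |(W x y).toReal - (riemDist ι g x y).toReal ^ 2| ≤ C * (riemDist ι g x y).toReal ^ 3)
    {x : ℝ → Y} {v : ℝ → V} (h : HasVelocity ι x v) {K : ℕ} (hK : 1 ≤ K)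
    (hKδ : √((∫ t, g (x t) (v t) (v t) ∂unitMeasure) / K) ≤ δ) :
    (K : ℝ) * ∑ k ∈ Finset.range K, (W (x ((k : ℝ) / K)) (x (((k + 1 : ℕ) : ℝ) / K))).toReal ≤
      (∫ t, g (x t) (v t) (v t) ∂unitMeasure) *
        (1 + |C| * √((∫ t, g (x t) (v t) (v t) ∂unitMeasure) / K)) := by
  have hK' : (0 : ℝ) < K := by exact_mod_cast hK
  set E := ∫ t, g (x t) (v t) (v t) ∂unitMeasure with hE
  set r := √(E / K)
  have hint : Integrable (fun t => g (x t) (v t) (v t)) unitMeasure :=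
    hg.integrable h.aestronglyMeasurable h.1 h.1
  have hsum := sum_integral_grid hK hint le_rfl
  rw [div_self hK'.ne', ← integral_unitMeasure, ← hE] at hsum
  have hterm : ∀ k ∈ Finset.range K,
      (W (x ((k : ℝ) / K)) (x (((k + 1 : ℕ) : ℝ) / K))).toReal ≤
        (1 / K) * (∫ t in ((k : ℝ) / K)..(((k + 1 : ℕ) : ℝ) / K), g (x t) (v t) (v t)) *
          (1 + |C| * r) := fun k hk => by
    have hk := Finset.mem_range.1 hk
    have m1 := grid_mem (n := k) hK (by omega)
    have m2 := grid_mem (n := k + 1) hK (by omega)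
    have hlt : (k : ℝ) / K < ((k + 1 : ℕ) : ℝ) / K := by
      gcongr
      simp
    set e := ∫ t in ((k : ℝ) / K)..(((k + 1 : ℕ) : ℝ) / K), g (x t) (v t) (v t) with he
    have he0 : 0 ≤ e := intervalIntegral.integral_nonneg hlt.le fun _ _ => hg.nonneg _ _
    have heE : e ≤ E := by
      rw [hE, integral_unitMeasure]
      exact intervalIntegral.integral_mono_interval m1.1 hlt.le m2.2
        (Eventually.of_forall fun _ => hg.nonneg _ _) (integrable_unitMeasure_iff.1 hint)
    have hd := riemDist_le_of_hasVelocity hg h m1 m2 hlt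
    rw [grid_succ_sub, ← he] at hd
    have hsr : √(1 / K * e) ≤ r := Real.sqrt_le_sqrt (by
      rw [one_div_mul_eq_div]; gcongr)
    have hd' := ENNReal.toReal_le_of_le_ofReal (Real.sqrt_nonneg _) hd
    obtain ⟨-, hW2⟩ := hW _ _ (hd.trans (ENNReal.ofReal_le_ofReal (hsr.trans hKδ)))
    set d := (riemDist ι g (x ((k : ℝ) / K)) (x (((k + 1 : ℕ) : ℝ) / K))).toReal
    have hd0 : 0 ≤ d := ENNReal.toReal_nonneg
    have hd2 : d ^ 2 ≤ 1 / K * e := (Real.le_sqrt hd0 (by positivity)).1 hd'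
    have hC : C * d ^ 3 ≤ |C| * r * d ^ 2 := by
      calc C * d ^ 3 ≤ |C| * d ^ 3 := by gcongr; exact le_abs_self C
        _ = |C| * d * d ^ 2 := by ring
        _ ≤ _ := by gcongr; exact hd'.trans hsr
    have hr0 : 0 ≤ 1 + |C| * r := by positivity
    calc _ ≤ d ^ 2 * (1 + |C| * r) := by linarith [(abs_le.1 hW2).2]
      _ ≤ _ := mul_le_mul_of_nonneg_right hd2 hr0
  calc _ ≤ (K : ℝ) * ∑ k ∈ Finset.range K, (1 / K) *
        (∫ t in ((k : ℝ) / K)..(((k + 1 : ℕ) : ℝ) / K), g (x t) (v t) (v t)) * (1 + |C| * r) :=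
        mul_le_mul_of_nonneg_left (Finset.sum_le_sum hterm) hK'.le
    _ = _ := by
        rw [← Finset.sum_mul, ← Finset.mul_sum, hsum]
        field_simp

/-- If the discrete energy is at most `A` and `K` is large, the coercivity of `W` makes the steps
shorter than `ε`; then `W` is close to the squared distance and hence to the metric at the left
node. -/
theorem step_energy_le_discrete_energy (hι : Function.Injective ι)
    (hg : IsUniformMetric g cs Cs β) {C δ : ℝ}
    (hW : ∀ x y, riemDist ι g x y ≤ ENNReal.ofReal δ → W x y ≠ ⊤ ∧
      |(W x y).toReal - (riemDist ι g x y).toReal ^ 2| ≤ C * (riemDist ι g x y).toReal ^ 3)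
    {γ : ℝ → ℝ} (hγ : IsModulus γ)
    (hWcoer : ∀ x y, riemDist ι g x y ≠ ⊤ →
      ((γ (riemDist ι g x y).toReal : ℝ) : EReal) ≤ W x y)
    {K : ℕ} {y : ℕ → Y} {u : ℕ → V} (hy : ∀ k < K, y (k + 1) = y k + ι (u k))
    (htop : ∀ k < K, W (y k) (y (k + 1)) ≠ ⊤) {A ε : ℝ} (hε : 0 < ε) (hεδ : ε ≤ δ)
    (hCε : |C| * ε ≤ 1)
    (hA : (K : ℝ) * ∑ k ∈ Finset.range K, (W (y k) (y (k + 1))).toReal ≤ A)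
    (hAK : A < K * γ ε) :
    (1 - |C| * ε) * ((K : ℝ) * ∑ k ∈ Finset.range K, g (y k) (u k) (u k)) ≤
      (1 + β (‖ι‖ * (ε / √cs)) / cs) * A := by
  set B := 1 + β (‖ι‖ * (ε / √cs)) / cs
  have hB : 0 ≤ B := by
    have := hg.modulus.nonneg (r := ‖ι‖ * (ε / √cs)) (by positivity)
    have := div_nonneg this hg.pos.le
    positivity
  have hfin : ∀ k < K, riemDist ι g (y k) (y (k + 1)) ≠ ⊤ := fun k hk => by
    rw [hy k hk]
    exact riemDist_ne_top hg _ _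
  have hγW : ∀ k < K, γ (riemDist ι g (y k) (y (k + 1))).toReal ≤ (W (y k) (y (k + 1))).toReal :=
    fun k hk => by
      have := EReal.toReal_le_toReal (hWcoer _ _ (hfin k hk)) (EReal.coe_ne_bot _) (htop k hk)
      rwa [EReal.toReal_coe] at this
  have hW0 : ∀ k ∈ Finset.range K, 0 ≤ (W (y k) (y (k + 1))).toReal := fun k hk =>
    (hγ.nonneg ENNReal.toReal_nonneg).trans (hγW k (Finset.mem_range.1 hk))
  have hterm : ∀ k ∈ Finset.range K,
      (1 - |C| * ε) * g (y k) (u k) (u k) ≤ B * (W (y k) (y (k + 1))).toReal := fun k hk => by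
    have hk' := Finset.mem_range.1 hk
    have hK' : (0 : ℝ) < K := by exact_mod_cast (by omega : 0 < K)
    have hlt : (riemDist ι g (y k) (y (k + 1))).toReal < ε := by
      by_contra! hle
      have h1 : γ ε ≤ (W (y k) (y (k + 1))).toReal := (hγ.mono hε.le hle).trans (hγW k hk')
      have h2 := h1.trans (Finset.single_le_sum hW0 hk)
      have h3 := mul_le_mul_of_nonneg_left h2 hK'.le
      linarith
    have hgd : g (y k) (u k) (u k) ≤ B * (riemDist ι g (y k) (y (k + 1))).toReal ^ 2 := by
      rw [hy k hk'] at hlt ⊢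
      exact apply_le_riemDist_sq hι hg _ _ hlt
    have hle : riemDist ι g (y k) (y (k + 1)) ≤ ENNReal.ofReal δ := by
      rw [← ENNReal.ofReal_toReal (hfin k hk')]
      exact ENNReal.ofReal_le_ofReal (hlt.le.trans hεδ)
    have h4 := (abs_le.1 (hW _ _ hle).2).1
    set d := (riemDist ι g (y k) (y (k + 1))).toReal
    have hd0 : 0 ≤ d := ENNReal.toReal_nonneg
    have hC : C * d ^ 3 ≤ |C| * ε * d ^ 2 := by
      calc C * d ^ 3 ≤ |C| * d ^ 3 := by gcongr; exact le_abs_self C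
        _ = |C| * d * d ^ 2 := by ring
        _ ≤ _ := by gcongr
    calc (1 - |C| * ε) * g (y k) (u k) (u k) ≤ (1 - |C| * ε) * (B * d ^ 2) :=
          mul_le_mul_of_nonneg_left hgd (by linarith)
      _ = B * ((1 - |C| * ε) * d ^ 2) := by ring
      _ ≤ _ := mul_le_mul_of_nonneg_left (by linarith) hB
  calc _ = (K : ℝ) * ∑ k ∈ Finset.range K, (1 - |C| * ε) * g (y k) (u k) (u k) := by
        rw [← Finset.mul_sum]; ring
    _ ≤ (K : ℝ) * ∑ k ∈ Finset.range K, B * (W (y k) (y (k + 1))).toReal :=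
        mul_le_mul_of_nonneg_left (Finset.sum_le_sum hterm) (Nat.cast_nonneg _)
    _ = B * ((K : ℝ) * ∑ k ∈ Finset.range K, (W (y k) (y (k + 1))).toReal) := by
        rw [← Finset.mul_sum]; ring
    _ ≤ B * A := mul_le_mul_of_nonneg_left hA hB

/-- The energies of the piecewise linear interpolations, with the metric frozen at the left nodes,
are asymptotically bounded by the energy of any path of finite energy with the same end points. -/
theorem eventually_step_energy_le (hι : Function.Injective ι) (hg : IsUniformMetric g cs Cs β)
    {C δ : ℝ} (hδ : 0 < δ)
    (hW : ∀ x y, riemDist ι g x y ≤ ENNReal.ofReal δ → W x y ≠ ⊤ ∧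
      |(W x y).toReal - (riemDist ι g x y).toReal ^ 2| ≤ C * (riemDist ι g x y).toReal ^ 3)
    (hWbot : ∀ x y, W x y ≠ ⊥) {γ : ℝ → ℝ} (hγ : IsModulus γ)
    (hWcoer : ∀ x y, riemDist ι g x y ≠ ⊤ →
      ((γ (riemDist ι g x y).toReal : ℝ) : EReal) ≤ W x y)
    {xA xB : Y} (hWtop : ∀ x ∈ manifold ι xA, ∀ y ∈ manifold ι xA, W x y ≠ ⊤)
    {x : ℝ → Y} {v : ℝ → V} (h : HasVelocity ι x v) (h0 : x 0 = xA) (h1 : x 1 = xB)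
    {xd : ℕ → ℕ → Y} (hxd : ∀ K, 1 ≤ K → IsDiscreteGeodesic ι W xA xB K (xd K))
    {c : ℕ → ℕ → V} (hc : ∀ K, 1 ≤ K → ∀ k ≤ K, xd K k = xA + ι (c K k)) {η : ℝ} (hη : 0 < η) :
    ∀ᶠ K : ℕ in atTop,
      ∫ t, g (xd K ⌊(K : ℝ) * t⌋₊) (stepVel K (c K) t) (stepVel K (c K) t) ∂unitMeasure ≤
        (∫ t, g (x t) (v t) (v t) ∂unitMeasure) + η := by
  set E := ∫ t, g (x t) (v t) (v t) ∂unitMeasure with hE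
  have hE0 : 0 ≤ E := integral_nonneg fun _ => hg.nonneg _ _
  -- a small `ε` with `(1 + β(‖ι‖ε/√cs)/cs) (E + ε) < (1 - |C|ε) (E + η)`
  obtain ⟨ε, hε, hεδ, hCε, hmain⟩ : ∃ ε, 0 < ε ∧ ε ≤ δ ∧ |C| * ε < 1 ∧
      (1 + β (‖ι‖ * (ε / √cs)) / cs) * (E + ε) < (1 - |C| * ε) * (E + η) := by
    have hid : Tendsto (fun ε : ℝ => ε) (𝓝[>] 0) (𝓝 0) :=
      tendsto_nhdsWithin_of_tendsto_nhds tendsto_id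
    have hpos : ∀ᶠ ε : ℝ in 𝓝[>] 0, 0 < ε := self_mem_nhdsWithin
    have t0 : Tendsto (fun ε : ℝ => ‖ι‖ * (ε / √cs)) (𝓝[>] 0) (𝓝 0) := by
      simpa using (hid.div_const (√cs)).const_mul ‖ι‖
    have tβ := hg.modulus.tendsto_zero
      (hpos.mono fun ε hε => by positivity) t0
    have tl : Tendsto (fun ε : ℝ => (1 + β (‖ι‖ * (ε / √cs)) / cs) * (E + ε)) (𝓝[>] 0) (𝓝 E) := by
      simpa using ((tβ.div_const cs).const_add 1).mul (hid.const_add E)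
    have tC : Tendsto (fun ε : ℝ => |C| * ε) (𝓝[>] 0) (𝓝 0) := by simpa using hid.const_mul |C|
    have tr : Tendsto (fun ε : ℝ => (1 - |C| * ε) * (E + η)) (𝓝[>] 0) (𝓝 (E + η)) := by
      simpa using (tC.const_sub 1).mul_const (E + η)
    obtain ⟨ε, a1, a2, a3, a4⟩ := (hpos.and ((hid.eventually_lt_const hδ).and
      ((tC.eventually_lt_const one_pos).and
        (tl.eventually_lt tr (by linarith : E < E + η))))).exists
    exact ⟨ε, a1, a2.le, a3, a4⟩
  have hr : Tendsto (fun K : ℕ => √(E / K)) atTop (𝓝 0) := by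
    simpa using (tendsto_const_div_atTop_nhds_zero_nat E).sqrt
  have hA : Tendsto (fun K : ℕ => E * (1 + |C| * √(E / K))) atTop (𝓝 E) := by
    simpa using ((hr.const_mul |C|).const_add 1).const_mul E
  have hγε : 0 < γ ε := by
    simpa [hγ.2.2] using hγ.1 (by simp : (0 : ℝ) ∈ Ici 0) hε.le hε
  have hbig : Tendsto (fun K : ℕ => (K : ℝ) * γ ε) atTop atTop :=
    tendsto_natCast_atTop_atTop.atTop_mul_const hγε
  filter_upwards [eventually_ge_atTop 1, hr.eventually_lt_const hδ,
    hA.eventually_lt_const (by linarith : E < E + ε), hbig.eventually_gt_atTop (E + ε)]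
    with K hK hKδ hAK hKγ
  have hK' : (K : ℝ) ≠ 0 := by exact_mod_cast (by omega : K ≠ 0)
  obtain ⟨⟨hd0, hdK, hdm⟩, hmin⟩ := hxd K hK
  have htop : ∀ k < K, W (xd K k) (xd K (k + 1)) ≠ ⊤ := fun k hk =>
    hWtop _ (hdm k (by omega)) _ (hdm (k + 1) (by omega))
  have hsm : ∀ k ≤ K, x ((k : ℝ) / K) ∈ manifold ι xA := fun k hk =>
    ⟨_, by rw [h.2 _ (grid_mem hK hk), h0]⟩
  have hsamp : IsDiscretePath ι xA xB K fun k => x ((k : ℝ) / K) :=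
    ⟨by simp [h0], by simp [div_self hK', h1], hsm⟩
  have hle := hmin _ hsamp
  rw [discreteEnergy_eq_coe hWbot htop, discreteEnergy_eq_coe hWbot
    fun k hk => hWtop _ (hsm k (by omega)) _ (hsm (k + 1) (by omega)), EReal.coe_le_coe_iff] at hle
  have hdA := (hle.trans (sampled_energy_le hg hW h hK hKδ.le)).trans hAK.le
  have hy : ∀ k < K, xd K (k + 1) = xd K k + ι (c K (k + 1) - c K k) := fun k hk => by
    rw [hc K hK _ (by omega), hc K hK k (by omega), map_sub]
    abel
  have hfin := step_energy_le_discrete_energy hι hg hW hγ hWcoer hy htop hε hεδ hCε.le hdA hKγ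
  rw [integral_step_energy g hK]
  have hpos : 0 < 1 - |C| * ε := by linarith
  exact le_of_mul_le_mul_left (hfin.trans hmain.le) hpos

end DiscreteEnergy

/-! ### Strong convergence of the velocities -/

section StrongConvergence

variable {Y V : Type*} [NormedAddCommGroup Y] [NormedSpace ℝ Y]
  [NormedAddCommGroup V] [NormedSpace ℝ V] [CompleteSpace V]

theorem hasVelocity_interpolate (ι : V →L[ℝ] Y) {K : ℕ} (hK : 1 ≤ K) {xA : Y}
    {x : ℕ → Y} {c : ℕ → V} (hc : ∀ k ≤ K, x k = xA + ι (c k)) :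
    HasVelocity ι (interpolate K x) (stepVel K c) := by
  refine ⟨memLp_stepVel K c 2, fun t ht => ?_⟩
  rw [interpolate_eq_integral ι hK hc ht, interpolate_eq_integral ι hK hc (by simp : (0 : ℝ) ∈ _)]
  simp

/-- Between two nodes, the interpolation stays close to the left node. -/
theorem norm_interpolate_sub_node_le (ι : V →L[ℝ] Y) {K : ℕ} (hK : 1 ≤ K) {xA : Y}
    {x : ℕ → Y} {c : ℕ → V} (hc : ∀ k ≤ K, x k = xA + ι (c k)) {t : ℝ} (ht : t ∈ Icc (0 : ℝ) 1) :
    ‖interpolate K x t - x ⌊(K : ℝ) * t⌋₊‖ ≤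
      ‖ι‖ * (√(1 / K) * √(∫ s, ‖stepVel K c s‖ ^ 2 ∂unitMeasure)) := by
  have hK' : (0 : ℝ) < K := by exact_mod_cast hK
  set n := ⌊(K : ℝ) * t⌋₊ with hn
  have hnK : n ≤ K := floor_le_of_mem ht
  have h1 : (n : ℝ) / K ≤ t := by
    rw [div_le_iff₀ hK', mul_comm]
    exact Nat.floor_le (mul_nonneg hK'.le ht.1)
  have h2 : t - (n : ℝ) / K ≤ 1 / K := by
    rw [← grid_succ_sub n]
    gcongr
    rw [le_div_iff₀ hK', mul_comm]
    exact_mod_cast (Nat.lt_floor_add_one ((K : ℝ) * t)).le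
  have hnode : interpolate K x ((n : ℝ) / K) = x n := by
    rw [interpolate, mul_div_cancel₀ _ hK'.ne']
    simp
  rw [← hnode]
  refine ((hasVelocity_interpolate ι hK hc).norm_sub_le (grid_mem hK hnK) ht h1).trans ?_
  gcongr

/-- Weak convergence together with an asymptotic upper bound on the energies gives strong
convergence of the velocities. The metrics of the approximating paths may be evaluated at base
points `X n` that converge uniformly to the limit path. -/
theorem tendsto_integral_norm_sub_sq
    (hrefl : Function.Surjective (NormedSpace.inclusionInDoubleDual ℝ V))
    {ι : V →L[ℝ] Y} (hι : Function.Injective ι) {g : Y → V →L[ℝ] V →L[ℝ] ℝ} {cs Cs : ℝ}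
    {β : ℝ → ℝ} (hg : IsUniformMetric g cs Cs β) {x : ℝ → Y} {v : ℝ → V} (h : HasVelocity ι x v)
    {X : ℕ → ℝ → Y} {u : ℕ → ℝ → V} (hX : ∀ n, AEStronglyMeasurable (X n) unitMeasure)
    (hu : ∀ n, MemLp (u n) 2 unitMeasure)
    (hunif : ∀ ε > 0, ∀ᶠ n in atTop, ∀ t ∈ Ioo (0 : ℝ) 1, ‖x t - X n t‖ ≤ ε)
    (hpt : ∀ t ∈ Icc (0 : ℝ) 1,
      Tendsto (fun n => ι (∫ s in (0 : ℝ)..t, (u n s - v s))) atTop (𝓝 0))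
    {M : ℝ} (hM : ∀ᶠ n in atTop, ∫ t, ‖u n t - v t‖ ^ 2 ∂unitMeasure ≤ M)
    (hE : ∀ η > 0, ∀ᶠ n in atTop, ∫ t, g (X n t) (u n t) (u n t) ∂unitMeasure ≤
      (∫ t, g (x t) (v t) (v t) ∂unitMeasure) + η) :
    Tendsto (fun n => ∫ t, ‖u n t - v t‖ ^ 2 ∂unitMeasure) atTop (𝓝 0) := by
  set E := ∫ t, g (x t) (v t) (v t) ∂unitMeasure with hEdef
  have hxm := h.aestronglyMeasurable
  have hw : ∀ n, MemLp (fun t => u n t - v t) 2 unitMeasure := fun n => (hu n).sub h.1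
  have hweak := tendsto_integral_apply hrefl hι hw hM hpt (hg.memLp_apply hxm h.1)
  have hexp : ∀ n, ∫ t, g (x t) (u n t) (u n t) ∂unitMeasure =
      E + 2 * ∫ t, g (x t) (v t) (u n t - v t) ∂unitMeasure +
        ∫ t, g (x t) (u n t - v t) (u n t - v t) ∂unitMeasure := fun n => by
    have i1 := hg.integrable hxm h.1 h.1
    have i2 := (hg.integrable hxm h.1 (hw n)).const_mul 2
    have i12 : Integrable (fun t => g (x t) (v t) (v t) + 2 * g (x t) (v t) (u n t - v t))
      unitMeasure := i1.add i2
    rw [hEdef, ← integral_const_mul, ← integral_add i1 i2,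
      ← integral_add i12 (hg.integrable hxm (hw n) (hw n))]
    refine integral_congr_ae (Eventually.of_forall fun t => ?_)
    simp only [map_sub, sub_apply, hg.symm (x t) (u n t) (v t)]
    ring
  rw [Metric.tendsto_nhds]
  intro ε hε
  obtain ⟨s, hs, hsmain⟩ : ∃ s, 0 < s ∧ (1 + β s / cs) * (E + s) + 2 * s < E + cs * ε := by
    have hid : Tendsto (fun s : ℝ => s) (𝓝[>] 0) (𝓝 0) :=
      tendsto_nhdsWithin_of_tendsto_nhds tendsto_id
    have hpos : ∀ᶠ s : ℝ in 𝓝[>] 0, 0 < s := self_mem_nhdsWithin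
    have tβ := hg.modulus.tendsto_zero (hpos.mono fun s hs => hs.le) hid
    have tl : Tendsto (fun s : ℝ => (1 + β s / cs) * (E + s) + 2 * s) (𝓝[>] 0) (𝓝 E) := by
      simpa using (((tβ.div_const cs).const_add 1).mul (hid.const_add E)).add (hid.const_mul 2)
    obtain ⟨s, a1, a2⟩ := (hpos.and (tl.eventually_lt_const
      (by linarith [mul_pos hg.pos hε] : E < E + cs * ε))).exists
    exact ⟨s, a1, a2⟩
  filter_upwards [hunif s hs, hE s hs, (Metric.tendsto_nhds.1 hweak) s hs] with n h1 h2 h3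
  rw [dist_zero_right, Real.norm_eq_abs] at h3 ⊢
  rw [abs_of_nonneg (integral_nonneg fun _ => by positivity)]
  have h4 := hg.integral_le_of_dist_le (hX n) hxm (hu n) h1
  have hB : 0 ≤ 1 + β s / cs := by
    have := div_nonneg (hg.modulus.nonneg hs.le) hg.pos.le
    linarith
  have h5 := mul_le_mul_of_nonneg_left h2 hB
  have h6 := hg.integral_sq_le hxm (hw n)
  have h7 := hexp n
  have h8 := (abs_lt.1 h3).1
  refine lt_of_mul_lt_mul_left ?_ hg.pos.le
  linarith

end StrongConvergence

end DiscreteGeodesics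

theorem theorem4p9 {Y V : Type*}
    [NormedAddCommGroup Y] [NormedSpace ℝ Y] [CompleteSpace Y]
    [NormedAddCommGroup V] [NormedSpace ℝ V] [CompleteSpace V]
    [TopologicalSpace.SeparableSpace V]
    -- `V` is reflexive and compactly embedded in `Y`
    (hrefl : Function.Surjective (NormedSpace.inclusionInDoubleDual ℝ V))
    (ι : V →L[ℝ] Y) (hι : Function.Injective ι) (hιc : IsCompactOperator ι)
    -- the metric: symmetric, bounded, coercive, uniformly continuous in the base point
    (g : Y → V →L[ℝ] V →L[ℝ] ℝ) (cs Cs : ℝ) (β : ℝ → ℝ)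
    (hgsymm : ∀ x v w, g x v w = g x w v)
    (hcs : 0 < cs)
    (hgcoer : ∀ x v, cs * ‖v‖ ^ 2 ≤ g x v v)
    (hgbdd : ∀ x v, g x v v ≤ Cs * ‖v‖ ^ 2)
    (hβ : DiscreteGeodesics.IsModulus β)
    (hgcont : ∀ x y v, |g x v v - g y v v| ≤ β ‖x - y‖ * ‖v‖ ^ 2)
    -- the local approximation `W : Y × Y → ℝ ∪ {∞}` of the squared Riemannian distance
    (W : Y → Y → EReal)
    (hWbot : ∀ x y, W x y ≠ ⊥)
    (hWlsc : LowerSemicontinuous fun p : Y × Y => W p.1 p.2)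
    (hWdist : ∃ C δ : ℝ, 0 < δ ∧ ∀ x y,
      DiscreteGeodesics.riemDist ι g x y ≤ ENNReal.ofReal δ →
        W x y ≠ ⊤ ∧
        |(W x y).toReal - (DiscreteGeodesics.riemDist ι g x y).toReal ^ 2|
          ≤ C * (DiscreteGeodesics.riemDist ι g x y).toReal ^ 3)
    (γ : ℝ → ℝ) (hγ : DiscreteGeodesics.IsModulus γ)
    (hWcoer : ∀ x y, DiscreteGeodesics.riemDist ι g x y ≠ ⊤ →
      ((γ (DiscreteGeodesics.riemDist ι g x y).toReal : ℝ) : EReal) ≤ W x y)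
    -- the end points
    (xA xB : Y) (hxB : xB ∈ DiscreteGeodesics.manifold ι xA)
    -- (H1)
    (H1 : ContDiff ℝ 2 g)
    -- (H2)
    (H2fin : ∀ x ∈ DiscreteGeodesics.manifold ι xA, ∀ y ∈ DiscreteGeodesics.manifold ι xA,
      W x y ≠ ⊤)
    (H2 : ContDiff ℝ 4 (DiscreteGeodesics.onManifold ι W xA))
    (H2bdd : ∀ j : ℕ, 1 ≤ j → j ≤ 4 → ∀ R : ℝ, ∃ C : ℝ, ∀ p : V × V, ‖p‖ ≤ R →
      ‖iteratedFDeriv ℝ j (DiscreteGeodesics.onManifold ι W xA) p‖ ≤ C)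
    -- a continuous geodesic and, for every `K ≥ 1`, a discrete geodesic of order `K`
    (x : ℝ → Y) (hx : DiscreteGeodesics.IsGeodesic ι g xA xB x)
    (xd : ℕ → ℕ → Y)
    (hxd : ∀ K, 1 ≤ K → DiscreteGeodesics.IsDiscreteGeodesic ι W xA xB K (xd K))
    -- convergence in `L²((0,1); Y)`
    (hconv : Tendsto
      (fun K : ℕ => eLpNorm (fun t => DiscreteGeodesics.interpolate K (xd K) t - x t) 2
        DiscreteGeodesics.unitMeasure) atTop (𝓝 0)) :
    -- membership in `W^{1,2}((0,1); xA + V)` of the curves, and convergence in this space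
    DiscreteGeodesics.w12Norm ι (fun t => x t - xA) < ⊤ ∧
    (∀ K, 1 ≤ K →
      DiscreteGeodesics.w12Norm ι
        (fun t => DiscreteGeodesics.interpolate K (xd K) t - xA) < ⊤) ∧
    Tendsto
      (fun K : ℕ => DiscreteGeodesics.w12Norm ι
        (fun t => DiscreteGeodesics.interpolate K (xd K) t - x t)) atTop (𝓝 0) := by
  open DiscreteGeodesics in
  have hg : IsUniformMetric g cs Cs β :=
    ⟨hgsymm, hcs, hgcoer, hgbdd, hβ, hgcont, H1.continuous⟩
  obtain ⟨hx0, hx1, hmin⟩ := hx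
  obtain ⟨C, δ, hδ, hW⟩ := hWdist
  -- the straight line has finite energy, hence so has the geodesic
  obtain ⟨v, hv⟩ : ∃ v, HasVelocity ι x v := by
    obtain ⟨u, hu⟩ := hxB
    have hline : HasVelocity ι (fun t : ℝ => xA + ι (t • u)) fun _ => u :=
      ⟨memLp_const u, fun t _ => by simp⟩
    have hlt := ((hmin _ (by simp) (by simp [hu])).trans (pathEnergy_le hg hline)).trans_lt
      ENNReal.ofReal_lt_top
    simp only [pathEnergy, iInf_lt_iff] at hlt
    obtain ⟨v, hv, -⟩ := hlt
    exact ⟨v, hv⟩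
  have hex : ∀ K k, ∃ u : V, 1 ≤ K → k ≤ K → xd K k = xA + ι u := fun K k => by
    by_cases h : 1 ≤ K ∧ k ≤ K
    · obtain ⟨u, hu⟩ := (hxd K h.1).1.2.2 k h.2
      exact ⟨u, fun _ _ => hu⟩
    · exact ⟨0, fun h1 h2 => absurd ⟨h1, h2⟩ h⟩
  choose c hc' using hex
  have hc : ∀ K, 1 ≤ K → ∀ k ≤ K, xd K k = xA + ι (c K k) := fun K hK k hk => hc' K k hK hk
  have hint0 : ∀ K, 1 ≤ K → interpolate K (xd K) 0 = xA := fun K hK => by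
    simp [interpolate, (hxd K hK).1.1]
  set w : ℕ → ℝ → V := fun K t => stepVel K (c K) t - v t with hw
  set z : ℕ → ℝ → Y := fun K t => interpolate K (xd K) t - x t with hz
  have hwm : ∀ K, MemLp (w K) 2 unitMeasure := fun K => (memLp_stepVel K (c K) 2).sub hv.1
  have hzw : ∀ K, 1 ≤ K → HasVelocity ι (z K) (w K) := fun K hK =>
    (hasVelocity_interpolate ι hK (hc K hK)).sub hv
  have hzint : ∀ K, 1 ≤ K → ∀ t ∈ Icc (0 : ℝ) 1, z K t = ι (∫ s in (0 : ℝ)..t, w K s) :=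
    fun K hK t ht => by
      rw [(hzw K hK).2 t ht]
      simp [hz, hint0 K hK, hx0]
  have hE := fun η (hη : 0 < η) => eventually_step_energy_le hι hg hδ hW hWbot hγ hWcoer H2fin hv
    hx0 hx1 hxd hc hη
  have hXm : ∀ K : ℕ, AEStronglyMeasurable (fun t : ℝ => xd K ⌊(K : ℝ) * t⌋₊) unitMeasure :=
    fun K => (stronglyMeasurable_step K (xd K)).aestronglyMeasurable
  set E := ∫ t, g (x t) (v t) (v t) ∂unitMeasure
  have hvel : ∀ᶠ K : ℕ in atTop, ∫ t, ‖stepVel K (c K) t‖ ^ 2 ∂unitMeasure ≤ (E + 1) / cs := by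
    filter_upwards [hE 1 one_pos] with K hK
    rw [le_div_iff₀ hcs, mul_comm]
    exact (hg.integral_sq_le (hXm K) (memLp_stepVel K (c K) 2)).trans hK
  have hM : ∀ᶠ K : ℕ in atTop, ∫ t, ‖w K t‖ ^ 2 ∂unitMeasure ≤
      2 * ((E + 1) / cs) + 2 * ∫ t, ‖v t‖ ^ 2 ∂unitMeasure := by
    filter_upwards [hvel] with K hK
    have i1 := ((memLp_stepVel K (c K) 2).norm.integrable_sq).const_mul 2
    have i2 := (hv.1.norm.integrable_sq).const_mul 2
    calc ∫ t, ‖w K t‖ ^ 2 ∂unitMeasure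
        ≤ ∫ t, (2 * ‖stepVel K (c K) t‖ ^ 2 + 2 * ‖v t‖ ^ 2) ∂unitMeasure := by
          refine integral_mono (hwm K).norm.integrable_sq (i1.add i2) fun t => ?_
          have h1 := pow_le_pow_left₀ (norm_nonneg _) (norm_sub_le (stepVel K (c K) t) (v t)) 2
          have h2 := sq_nonneg (‖stepVel K (c K) t‖ - ‖v t‖)
          simp only [hw]
          linarith
      _ ≤ _ := by
          rw [integral_add i1 i2, integral_const_mul, integral_const_mul]
          linarith
  have hzunif : ∀ ε > 0, ∀ᶠ K in atTop, ∀ t ∈ Icc (0 : ℝ) 1, ‖z K t‖ ≤ ε := fun ε hε =>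
    eventually_norm_le_of_tendsto ((eventually_ge_atTop 1).mono hzw) hM hconv hε
  have hpt : ∀ t ∈ Icc (0 : ℝ) 1, Tendsto (fun K => ι (∫ s in (0 : ℝ)..t, w K s)) atTop (𝓝 0) :=
    fun t ht => by
      rw [Metric.tendsto_nhds]
      intro ε hε
      filter_upwards [hzunif (ε / 2) (by positivity), eventually_ge_atTop 1] with K h1 hK
      rw [← hzint K hK t ht, dist_zero_right]
      linarith [h1 t ht]
  have hunif : ∀ ε > 0, ∀ᶠ K : ℕ in atTop, ∀ t ∈ Ioo (0 : ℝ) 1,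
      ‖x t - xd K ⌊(K : ℝ) * t⌋₊‖ ≤ ε := fun ε hε => by
    have hr : Tendsto (fun K : ℕ => ‖ι‖ * (√(1 / K) * √((E + 1) / cs))) atTop (𝓝 0) := by
      simpa using
        (((tendsto_const_div_atTop_nhds_zero_nat (1 : ℝ)).sqrt).mul_const
          (√((E + 1) / cs))).const_mul ‖ι‖
    filter_upwards [hzunif (ε / 2) (by positivity), eventually_ge_atTop 1, hvel,
      hr.eventually_lt_const (half_pos hε)] with K h1 hK h2 h3 t ht
    have ht' : t ∈ Icc (0 : ℝ) 1 := ⟨ht.1.le, ht.2.le⟩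
    have h4 := norm_interpolate_sub_node_le ι hK (hc K hK) ht'
    have h5 : ‖ι‖ * (√(1 / K) * √(∫ s, ‖stepVel K (c K) s‖ ^ 2 ∂unitMeasure)) ≤
        ‖ι‖ * (√(1 / K) * √((E + 1) / cs)) := by gcongr
    have h6 := norm_sub_le_norm_sub_add_norm_sub (x t) (interpolate K (xd K) t)
      (xd K ⌊(K : ℝ) * t⌋₊)
    have h7 := h1 t ht'
    rw [hz, norm_sub_rev] at h7
    linarith
  have hstrong := tendsto_integral_norm_sub_sq hrefl hι hg hv hXm
    (fun K => memLp_stepVel K (c K) 2) hunif hpt hM hE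
  refine ⟨?_, fun K hK => ?_, ?_⟩
  · refine (w12Norm_le ι hv.1 fun t ht => ?_).trans_lt
      (ENNReal.rpow_lt_top_of_nonneg (by norm_num) ENNReal.ofReal_ne_top)
    rw [hv.2 t ht, hx0, add_sub_cancel_left]
  · refine (w12Norm_le ι (memLp_stepVel K (c K) 2) fun t ht => ?_).trans_lt
      (ENNReal.rpow_lt_top_of_nonneg (by norm_num) ENNReal.ofReal_ne_top)
    rw [(hasVelocity_interpolate ι hK (hc K hK)).2 t ht, hint0 K hK, add_sub_cancel_left]
  · have hlim : Tendsto (fun K => ENNReal.ofReal (2 * ∫ t, ‖w K t‖ ^ 2 ∂unitMeasure) ^ (1 / 2 : ℝ))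
        atTop (𝓝 0) := by
      have h1 := (ENNReal.continuous_rpow_const (y := (1 / 2 : ℝ))).tendsto (ENNReal.ofReal (2 * 0))
      have h2 := h1.comp (ENNReal.tendsto_ofReal (hstrong.const_mul 2))
      simp only [mul_zero, ENNReal.ofReal_zero,
        ENNReal.zero_rpow_of_pos (by norm_num : (0 : ℝ) < 1 / 2)] at h2
      exact h2
    refine tendsto_of_tendsto_of_tendsto_of_le_of_le' tendsto_const_nhds hlim
      (Eventually.of_forall fun _ => zero_le) ?_
    filter_upwards [eventually_ge_atTop 1] with K hK
    exact w12Norm_le ι (hwm K) (hzint K hK)
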